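/- **Setting.** For every $m$ let $p_{1,m},\dots,p_{m,m}\in[0,1]$ be $p$-values on a probability space $(\Omega_m,\mathcal A_m,P_m)$, and let $\{1,\dots,m\}=I_{0,m}\cup I_{1,m}$ be a nonrandom disjoint decomposition into true and false nulls, $m_j=\#I_{j,m}$. Assume basic independence: the vectors $(p_{i,m})_{i\in I_{0,m}}$ and $(p_{i,m})_{i\in I_{1,m}}$ are independent, and $(p_{i,m})_{i\in I_{0,m}}$ are independent and uniformly distributed on $[0,1]$ (the joint law of $(p_{i,m})_{i\in I_{1,m}}$ is arbitrary). Let $\widehat F_m$ and $\widehat F_{1,m}$ be the empirical distribution functions of $(p_{i,m})_{i\le m}$ and $(p_{i,m})_{i\in I_{1,m}}$, and $R_m(t)=m\widehat F_m(t)$. For critical values $0=c_0<c_1\le\dots\le c_m<1$ the step-up test has $R_m=\max\{i\in\{0,\dots,m\}: p_{i:m}\le c_i\}$ rejections, where $p_{1:m}\le\dots\le p_{m:m}$ are the ordered $p$-values and $p_{0:m}=0$; it rejects the $i$-th null iff $p_{i,m}\le c_{R_m}$, has $V_m=\#\{i\in I_{0,m}:p_{i,m}\le c_{R_m}\}$ false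 rejections, and $\mathrm{FDR}_m=E(V_m/R_m)$ with $0/0=0$. The test is consistent if $V_m/R_m-E(V_m/R_m)\to0$ in $P_m$-probability. All limits are as $m\to\infty$; almost sure statements about such limits refer to an arbitrary joint law of the experiments $(\Omega_m,\mathcal A_m,P_m)$, $m\in\mathbb N$. Let $0<\alpha\le\lambda<1$ and $\lambda=\lambda_0<\lambda_1<\dots<\lambda_k=1$. Let $\widehat\beta_{i,m}\ge0$, $1\le i\le k$, be measurable functions of $(\widehat F_m(t))_{t\ge\lambda_i}$ with $\sum_{i=1}^k\widehat\beta_{i,m}=1$, and put $$\widetilde m_0=\sum_{i=1}^k\widehat\beta_{i,m}\,m\,\frac{\widehat F_m(\lambda_i)-\widehat F_m(\lambda_{i-1})+\frac1m}{\lambda_i-\lambda_{i-1}},\qquad \widehat m_0=\max\Bigl\{\widetilde m_0,\frac{\alpha}{\lambda}R_m(\lambda)\Bigr\}.$$ The adaptive test is the step-up test with critical values $\min\{i\alpha/\widehat m_0,\lambda\}$; the BH test is the one with critical values $i\alpha/m$, and its FDR is denoted $\mathrm{FDR}^{BH}_m$. Put $\widehat g_{i,m}=\widehat\beta_{i,m}/(\lambda_i-\lambda_{i-1})$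 for $1\le i\le k$ and $\widehat g_{0,m}=0$. Assume that $m_0/m\to\kappa_0\in(0,1]$ and $\kappa_0>\alpha(1-\kappa_0)/[\lambda(1-\alpha)]$. **Corollary.** (a) If $\kappa_0=1$, then $\widehat m_0/m\to1$ in $P_m$-probability and $\lim\mathrm{FDR}_m=\alpha=\lim\mathrm{FDR}_m^{BH}$. (b) Let $\kappa_0<1$ and suppose that for every $m$, almost surely, $\widehat g_{1,m}\le\widehat g_{2,m}\le\dots\le\widehat g_{k,m}$. Let $\varepsilon_i\in[0,1-\lambda_i]$, $0\le i\le k-1$, be such that $\liminf_m\widehat F_m(\lambda_i)\ge\lambda_i+\varepsilon_i$ almost surely for $0\le i\le k-1$. If there are $j\in\{1,\dots,k\}$ and $\delta>0$ with $\liminf_m(\widehat g_{j,m}-\widehat g_{j-1,m})\ge\delta$ almost surely and $\varepsilon_{j-1}>0$, then $$\liminf_{m\to\infty}\mathrm{FDR}_m>\kappa_0\alpha=\lim_{m\to\infty}\mathrm{FDR}_m^{BH}.$$ (c) Suppose that there are constants $\beta_i$ with $\widehat\beta_{i,m}\to\beta_i$ almost surely for $1\le i\le k$, that the monotonicity condition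 on the weights in (b) holds, and that $\lim_m\widehat F_{1,m}(\lambda_i)=\lambda_i+\varepsilon_i$ almost surely with some $\varepsilon_i\in[0,1-\lambda_i]$ for $0\le i\le k-1$. Put $g_i=\beta_i/(\lambda_i-\lambda_{i-1})$ for $1\le i\le k$ and $g_0=0$, and assume $g_j-g_{j-1}>0$ and $\varepsilon_{j-1}>0$ for some $j\in\{1,\dots,k\}$. If $\kappa_0=1$, assume in addition $m_1/\sqrt m\to\infty$. Then there is $C_0\in[\kappa_0\alpha,1]$ such that $\widehat m_0/m\to C_0$ in $P_m$-probability, and - consistency of the BH test implies consistency of the adaptive test; - if there are $\delta>0$ and $t_m\in(0,\lambda)$ with $mt_m\to\infty$ and $$P_m\Bigl(\frac{m_1}{m}\frac{\widehat F_{1,m}(t_m)}{t_m}\ge\delta-\kappa_0+\frac{C_0}{\alpha}\Bigr)\to1,$$ then the adaptive test is consistent. -/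

import Mathlib

open MeasureTheory ProbabilityTheory Filter Topology

noncomputable section

namespace MultipleTesting

/-- Basic independence (BI) for the `p`-values `p · 1, …, p · m` with set `I₀` of true nulls:
the vector of `p`-values of the true nulls is independent of the vector of `p`-values of the
false nulls, and the former consists of independent, uniformly distributed variables. The joint
law of the `p`-values of the false nulls is arbitrary. -/
structure BasicIndependence {Ω : Type*} [MeasurableSpace Ω] (P : Measure Ω) {m : ℕ}
    (p : Ω → Fin m → ℝ) (I₀ : Finset (Fin m)) : Prop where
  measurable : ∀ i, Measurable fun ω => p ω i
  mem_Icc : ∀ ω i, p ω i ∈ Set.Icc (0 : ℝ) 1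
  indep_true_false :
    IndepFun (fun ω (i : {i // i ∈ I₀}) => p ω i) (fun ω (i : {i // i ∉ I₀}) => p ω i) P
  indep_true : iIndepFun (fun (i : {i // i ∈ I₀}) ω => p ω i) P
  uniform_true : ∀ i ∈ I₀, ∀ x ∈ Set.Icc (0 : ℝ) 1, P {ω | p ω i ≤ x} = ENNReal.ofReal x

/-- Empirical distribution function at `t` of the values `q i`, `i ∈ s` (`0` if `s` is empty). -/
def empCDF {m : ℕ} (s : Finset (Fin m)) (q : Fin m → ℝ) (t : ℝ) : ℝ :=
  ((s.filter fun i => q i ≤ t).card : ℝ) / (s.card : ℝ)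

/-- The `i`-th smallest of the values `q 1, …, q m` for `1 ≤ i ≤ m`; the `0`-th one is `0`. -/
def orderStat {m : ℕ} (q : Fin m → ℝ) (i : ℕ) : ℝ :=
  if h : 1 ≤ i ∧ i ≤ m then q (Tuple.sort q ⟨i - 1, by omega⟩) else 0

open Classical in
/-- Number of rejections `max {i = 0, …, m : p_{i:m} ≤ c i}` of the step-up test with critical
values `c`. -/
def numRej {m : ℕ} (c : ℕ → ℝ) (q : Fin m → ℝ) : ℕ :=
  Nat.findGreatest (fun i => orderStat q i ≤ c i) m

/-- Number of falsely rejected hypotheses: the `i`-th null is rejected iff its `p`-value is at most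
the critical value with index `numRej c q`. -/
def numFalseRej {m : ℕ} (c : ℕ → ℝ) (q : Fin m → ℝ) (I₀ : Finset (Fin m)) : ℕ :=
  (I₀.filter fun i => q i ≤ c (numRej c q)).card

/-- False discovery proportion `V / R`, with `0 / 0 = 0`. -/
def FDP {m : ℕ} (c : ℕ → ℝ) (q : Fin m → ℝ) (I₀ : Finset (Fin m)) : ℝ :=
  (numFalseRej c q I₀ : ℝ) / (numRej c q : ℝ)

/-- Critical values `i α / m` of the Benjamini-Hochberg test. -/
def critBH (α : ℝ) (m : ℕ) (i : ℕ) : ℝ := (i : ℝ) / (m : ℝ) * α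

/-- Critical values `min (i α / m₀) l` of the adaptive test with estimate `m₀` and cap `l`. -/
def critAdaptive (α l m₀ : ℝ) (i : ℕ) : ℝ := min ((i : ℝ) / m₀ * α) l

/-- The estimator of the number of true nulls on the interval `(lam (i - 1), lam i]`, `1 ≤ i`. -/
def storeyInterval {m : ℕ} (lam : ℕ → ℝ) (q : Fin m → ℝ) (i : ℕ) : ℝ :=
  (m : ℝ) *
    ((empCDF Finset.univ q (lam i) - empCDF Finset.univ q (lam (i - 1)) + 1 / (m : ℝ)) /
      (lam i - lam (i - 1)))

/-- Weights `b i ((F_m(t))_{t ≥ lam i})` evaluated at the `p`-values `q`. -/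
def weights {m : ℕ} {lam : ℕ → ℝ} (b : ∀ i, (Set.Ici (lam i) → ℝ) → ℝ) (q : Fin m → ℝ) (i : ℕ) :
    ℝ :=
  b i fun t => empCDF Finset.univ q t

/-- The combined estimator `∑_{i=1}^k β i * storeyInterval lam q i`. -/
def storeyComb {m : ℕ} (k : ℕ) (lam : ℕ → ℝ) (β : ℕ → ℝ) (q : Fin m → ℝ) : ℝ :=
  ∑ i ∈ Finset.Icc 1 k, β i * storeyInterval lam q i

/-- The estimator of the adaptive test: the maximum of the combined estimator and
`(α / lam 0) R_m(lam 0)`, where `R_m(t) = m F_m(t)`. -/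
def storeyHat {m : ℕ} (α : ℝ) (k : ℕ) (lam : ℕ → ℝ) (β : ℕ → ℝ) (q : Fin m → ℝ) : ℝ :=
  max (storeyComb k lam β q) (α / lam 0 * ((m : ℝ) * empCDF Finset.univ q (lam 0)))

/-- Normalized weight `β i / (lam i - lam (i - 1))` for `1 ≤ i`, and `0` for `i = 0`. -/
def normWeight (lam : ℕ → ℝ) (β : ℕ → ℝ) (i : ℕ) : ℝ :=
  if i = 0 then 0 else β i / (lam i - lam (i - 1))

/-- `β 1 / (lam 1 - lam 0) ≤ β 2 / (lam 2 - lam 1) ≤ … ≤ β k / (lam k - lam (k - 1))`. -/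
def MonotoneWeights (k : ℕ) (lam : ℕ → ℝ) (β : ℕ → ℝ) : Prop :=
  ∀ i, 1 ≤ i → i < k → normWeight lam β i ≤ normWeight lam β (i + 1)

/-- False discovery proportion of the Benjamini-Hochberg test at level `α`. -/
def fdpBH {m : ℕ} (α : ℝ) (I₀ : Finset (Fin m)) (q : Fin m → ℝ) : ℝ :=
  FDP (critBH α m) q I₀

/-- False discovery proportion of the adaptive test based on `storeyHat`. -/
def fdpStorey {m : ℕ} (α : ℝ) (k : ℕ) (lam : ℕ → ℝ) (b : ∀ i, (Set.Ici (lam i) → ℝ) → ℝ)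
    (I₀ : Finset (Fin m)) (q : Fin m → ℝ) : ℝ :=
  FDP (critAdaptive α (lam 0) (storeyHat α k lam (weights b q) q)) q I₀

/-- Convergence `X m → c` in `P m`-probability along a sequence of probability spaces. -/
def ConvInProb {Ω : ℕ → Type*} [∀ m, MeasurableSpace (Ω m)] (P : ∀ m, Measure (Ω m))
    (X : ∀ m, Ω m → ℝ) (c : ℝ) : Prop :=
  ∀ η : ℝ, 0 < η → Tendsto (fun m => P m {ω | η ≤ |X m ω - c|}) atTop (𝓝 0)

/-- Consistency of a multiple test with false discovery proportions `X m`: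
`X m - E (X m) → 0` in `P m`-probability. -/
def Consistent {Ω : ℕ → Type*} [∀ m, MeasurableSpace (Ω m)] (P : ∀ m, Measure (Ω m))
    (X : ∀ m, Ω m → ℝ) : Prop :=
  ConvInProb P (fun m ω => X m ω - ∫ ω', X m ω' ∂(P m)) 0

/-- `Q` is a joint law of the sequence of experiments `(Ω m, P m)`. Almost sure statements about
`m → ∞` refer to such a joint law; it is not restricted otherwise. If all experiments live on one
probability space, `Q` is the image of its measure under the diagonal map. -/
def IsJointLaw {Ω : ℕ → Type*} [∀ m, MeasurableSpace (Ω m)] (P : ∀ m, Measure (Ω m))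
    (Q : Measure (∀ m, Ω m)) : Prop :=
  ∀ m, MeasurePreserving (Function.eval m) Q (P m)

end MultipleTesting

end

open MultipleTesting

/-! Both tests are step-up tests built on an estimate `M` of the number of true nulls that does not
change when a p-value below the cap `l` is set to zero (`NullEstimator`; for BH, `M = m` and `l =
1`). A true null is then rejected iff its p-value lies below a threshold that depends only on the
other p-values, hence is independent of this uniform variable. Integrating the p-value out turns
threshold over `R` into `α / M`. This gives E(V/R) = E(W) with W = (α/l) V(l)/M (`integral_FDP`),
and the same argument for pairs of nulls gives E((V/R)²) ≤ E(1/R) + E(W²) (`integral_FDP_sq_le`). So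
the FDR is governed by `M / m`, and a test is consistent once W has a constant limit and R tends to
infinity (`consistent_of_tendsto_rej`).

Summation by parts (`storeyComb_div_eq`) writes the combined estimator over m as 1, plus O(1/m),
minus the sum of the increments of the normalized weights times F(λ_i) - λ_i. For monotone weights
every increment is nonnegative, so an excess of F over the diagonal at one point with a positive
increment pushes the estimator below m (`storeyComb_div_le`). The condition on κ₀ keeps the other
branch of the maximum below m as well. This yields (b), and in (c) that the estimator is at most m.
If κ₀ = 1 the excess in (c) is only of order m₁/m, and m₁/√m → ∞ makes it dominate the fluctuations
of the null counts.

If the BH test is consistent, its number of rejections tends to infinity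
(`tendsto_rej_of_consistent`): otherwise, with probability bounded away from zero along a
subsequence, no true null is rejected, against a mean tending to κ₀α > 0. With an estimator at most
m the adaptive test rejects at least as much. The second criterion in (c) bounds R below directly by
the count of p-values at `t m`. -/

namespace MultipleTesting

/-! ### Convergence in probability as convergence along a filter. -/

/-- The filter of events of the sequence of experiments `(Ω m, P m)` whose probability tends
to one. -/
def whp {Ω : ℕ → Type*} [∀ m, MeasurableSpace (Ω m)] (P : ∀ m, Measure (Ω m)) :
    Filter (Σ m, Ω m) where
  sets := {S | Tendsto (fun m => P m {ω | (⟨m, ω⟩ : Σ m, Ω m) ∉ S}) atTop (𝓝 0)}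
  univ_sets := by simp
  sets_of_superset := by
    intro S T hS hST
    refine tendsto_of_tendsto_of_tendsto_of_le_of_le tendsto_const_nhds hS (fun _ => zero_le) ?_
    intro m
    exact measure_mono fun ω hω h => hω (hST h)
  inter_sets := by
    intro S T hS hT
    have h := Tendsto.add hS hT
    rw [add_zero] at h
    refine tendsto_of_tendsto_of_tendsto_of_le_of_le tendsto_const_nhds h (fun _ => zero_le) ?_
    intro m
    refine le_trans (measure_mono ?_) (measure_union_le _ _)
    intro ω hω
    simp only [Set.mem_ofPred_eq, Set.mem_inter_iff, not_and_or, Set.mem_union] at hω ⊢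
    exact hω

section Whp

variable {Ω : ℕ → Type*} [∀ m, MeasurableSpace (Ω m)] {P : ∀ m, Measure (Ω m)}

theorem eventually_whp_iff {p : (Σ m, Ω m) → Prop} :
    (∀ᶠ x in whp P, p x) ↔ Tendsto (fun m => P m {ω | ¬ p ⟨m, ω⟩}) atTop (𝓝 0) :=
  Iff.rfl

theorem convInProb_iff_tendsto_whp {X : ∀ m, Ω m → ℝ} {c : ℝ} :
    ConvInProb P X c ↔ Tendsto (fun x : Σ m, Ω m => X x.1 x.2) (whp P) (𝓝 c) := by
  rw [Metric.tendsto_nhds]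
  refine forall_congr' fun η => forall_congr' fun _ => ?_
  rw [eventually_whp_iff]
  simp only [Real.dist_eq, not_lt]

theorem tendsto_fst_whp : Tendsto (fun x : Σ m, Ω m => x.1) (whp P) atTop := by
  rw [tendsto_atTop]
  intro M
  rw [eventually_whp_iff]
  refine tendsto_const_nhds.congr' ?_
  filter_upwards [eventually_ge_atTop M] with m hm
  simp [hm]

theorem tendsto_const_div_fst_whp (c : ℝ) :
    Tendsto (fun x : Σ m, Ω m => c / (x.1 : ℝ)) (whp P) (𝓝 0) :=
  (tendsto_const_div_atTop_nhds_zero_nat c).comp tendsto_fst_whp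

theorem eventually_whp_of_forall_ae {p : ∀ m, Ω m → Prop} (h : ∀ m, ∀ᵐ ω ∂(P m), p m ω) :
    ∀ᶠ x in whp P, p x.1 x.2 := by
  rw [eventually_whp_iff]
  refine tendsto_const_nhds.congr fun m => ?_
  exact (ae_iff.1 (h m)).symm

/-- Measurability is needed to pass to complements: `whp` itself is defined by outer measures of
exceptional sets. -/
theorem eventually_whp_iff_tendsto_measure_one [∀ m, IsProbabilityMeasure (P m)]
    {p : ∀ m, Ω m → Prop} (hp : ∀ m, MeasurableSet {ω | p m ω}) :
    (∀ᶠ x in whp P, p x.1 x.2) ↔ Tendsto (fun m => P m {ω | p m ω}) atTop (𝓝 1) := by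
  rw [eventually_whp_iff]
  have h1 : ∀ m, P m {ω | ¬ p m ω} = 1 - P m {ω | p m ω} := fun m => prob_compl_eq_one_sub (hp m)
  have h2 : ∀ m, P m {ω | p m ω} = 1 - P m {ω | ¬ p m ω} := fun m => by
    have := prob_compl_eq_one_sub (μ := P m) (hp m).compl
    rwa [compl_compl] at this
  constructor
  · intro h
    have := ENNReal.Tendsto.sub (a := 1) (tendsto_const_nhds (x := (1 : ENNReal)) (f := atTop)) h
      (Or.inl ENNReal.one_ne_top)
    rw [tsub_zero] at this
    exact this.congr fun m => (h2 m).symm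
  · intro h
    have := ENNReal.Tendsto.sub (a := 1) (tendsto_const_nhds (x := (1 : ENNReal)) (f := atTop)) h
      (Or.inl ENNReal.one_ne_top)
    rw [tsub_self] at this
    exact this.congr fun m => (h1 m).symm

/-- Almost sure eventual events of a joint law hold with probability tending to one. -/
theorem eventually_whp_of_ae_eventually [∀ m, IsProbabilityMeasure (P m)]
    {Q : Measure (∀ m, Ω m)} (hQ : IsJointLaw P Q) {p : ∀ m, Ω m → Prop}
    (hp : ∀ m, MeasurableSet {ω | p m ω}) (h : ∀ᵐ ω ∂Q, ∀ᶠ m in atTop, p m (ω m)) :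
    ∀ᶠ x in whp P, p x.1 x.2 := by
  have hQp : IsProbabilityMeasure Q := ⟨by
    have := (hQ 0).measure_preimage (MeasurableSet.univ (α := Ω 0)).nullMeasurableSet
    rwa [Set.preimage_univ, measure_univ (μ := P 0)] at this⟩
  rw [eventually_whp_iff]
  have hm : ∀ m, MeasurableSet {ω : ∀ m, Ω m | ¬ p m (ω m)} := fun m =>
    (hQ m).measurable (hp m).compl
  have heq : ∀ m, P m {ω | ¬ p m ω} = Q {ω | ¬ p m (ω m)} := fun m =>
    ((hQ m).measure_preimage (hp m).compl.nullMeasurableSet).symm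
  simp only [heq]
  -- Almost surely only finitely many exceptional events occur, so their indicators tend to that of
  -- the empty set.
  have := tendsto_measure_of_ae_tendsto_indicator_of_isFiniteMeasure (μ := Q) (A := ∅)
    (As := fun m => {ω : ∀ m, Ω m | ¬ p m (ω m)}) (L := atTop) MeasurableSet.empty hm ?_
  · simpa using this
  · filter_upwards [h] with ω hω
    filter_upwards [hω] with m hm
    simp [hm]

theorem tendsto_whp_of_ae_tendsto [∀ m, IsProbabilityMeasure (P m)]
    {Q : Measure (∀ m, Ω m)} (hQ : IsJointLaw P Q) {X : ∀ m, Ω m → ℝ}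
    (hX : ∀ m, Measurable (X m)) {c : ℝ}
    (h : ∀ᵐ ω ∂Q, Tendsto (fun m => X m (ω m)) atTop (𝓝 c)) :
    Tendsto (fun x : Σ m, Ω m => X x.1 x.2) (whp P) (𝓝 c) := by
  rw [tendsto_def]
  intro s hs
  obtain ⟨t, hts, ht, hct⟩ := mem_nhds_iff.1 hs
  have := eventually_whp_of_ae_eventually hQ (p := fun m ω => X m ω ∈ t)
    (fun m => hX m ht.measurableSet)
    (h.mono fun ω hω => hω.eventually_mem (ht.mem_nhds hct))
  exact this.mono fun x hx => hts hx

/-- An almost sure lower bound on the lower limit holds in probability, up to a margin. -/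
theorem eventually_whp_lt_of_ae_le_liminf [∀ m, IsProbabilityMeasure (P m)]
    {Q : Measure (∀ m, Ω m)} (hQ : IsJointLaw P Q) {X : ∀ m, Ω m → ℝ}
    (hX : ∀ m, Measurable (X m)) {B : ℝ} (hB : ∀ m ω, B ≤ X m ω) {c c' : ℝ} (hc : c' < c)
    (h : ∀ᵐ ω ∂Q, c ≤ liminf (fun m => X m (ω m)) atTop) :
    ∀ᶠ x in whp P, c' < X x.1 x.2 := by
  refine eventually_whp_of_ae_eventually hQ (p := fun m ω => c' < X m ω)
    (fun m => measurableSet_lt measurable_const (hX m)) ?_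
  filter_upwards [h] with ω hω
  refine eventually_lt_of_lt_liminf (hc.trans_le hω) ?_
  exact isBoundedUnder_of ⟨B, fun m => hB m (ω m)⟩

/-- Bounded convergence along a sequence of experiments. -/
theorem tendsto_integral_of_tendsto_whp [∀ m, IsProbabilityMeasure (P m)] {X : ∀ m, Ω m → ℝ}
    (hX : ∀ m, Measurable (X m)) {B : ℝ} (hB : ∀ m ω, |X m ω| ≤ B) {c : ℝ}
    (h : Tendsto (fun x : Σ m, Ω m => X x.1 x.2) (whp P) (𝓝 c)) :
    Tendsto (fun m => ∫ ω, X m ω ∂(P m)) atTop (𝓝 c) := by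
  have hint : ∀ m, Integrable (X m) (P m) := fun m =>
    Integrable.of_bound (hX m).aestronglyMeasurable B (ae_of_all _ fun ω => hB m ω)
  rw [Metric.tendsto_nhds]
  intro η hη
  have hD : 0 < |B| + |c| + 1 := by positivity
  have h1 := (ENNReal.tendsto_toReal ENNReal.zero_ne_top).comp
    (convInProb_iff_tendsto_whp.2 h (η / 2) (by positivity))
  have h2 := (Metric.tendsto_nhds.1 h1) (η / (2 * (|B| + |c| + 1))) (by positivity)
  filter_upwards [h2] with m hm
  simp only [Function.comp_apply, ENNReal.toReal_zero, Real.dist_eq, sub_zero] at hm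
  rw [abs_of_nonneg ENNReal.toReal_nonneg] at hm
  set S : Set (Ω m) := {ω | η / 2 ≤ |X m ω - c|} with hS
  have hSm : MeasurableSet S :=
    measurableSet_le measurable_const ((hX m).sub_const c).abs
  -- The deviation is at most η/2 off the exceptional set and at most a constant on it, whose
  -- probability is already small compared with η.
  have hle : ∀ ω, |X m ω - c| ≤ η / 2 + S.indicator (fun _ => |B| + |c| + 1) ω := by
    intro ω
    by_cases hω : ω ∈ S
    · rw [Set.indicator_of_mem hω]
      have := abs_sub (X m ω) c
      have := hB m ω
      have := le_abs_self B
      linarith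
    · rw [Set.indicator_of_notMem hω]
      simp only [hS, Set.mem_ofPred_eq, not_le] at hω
      linarith
  have hi : Integrable (fun ω => η / 2 + S.indicator (fun _ => |B| + |c| + 1) ω) (P m) :=
    (integrable_const _).add ((integrable_const _).indicator hSm)
  calc dist (∫ ω, X m ω ∂(P m)) c = |∫ ω, (X m ω - c) ∂(P m)| := by
        rw [Real.dist_eq, integral_sub (hint m) (integrable_const _)]; simp
    _ ≤ ∫ ω, |X m ω - c| ∂(P m) := abs_integral_le_integral_abs
    _ ≤ ∫ ω, (η / 2 + S.indicator (fun _ => |B| + |c| + 1) ω) ∂(P m) :=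
        integral_mono ((hint m).sub (integrable_const _)).abs hi hle
    _ = η / 2 + (P m S).toReal * (|B| + |c| + 1) := by
        rw [integral_add (integrable_const _) ((integrable_const _).indicator hSm),
          integral_indicator hSm]
        simp [Measure.real]
    _ < η / 2 + η / (2 * (|B| + |c| + 1)) * (|B| + |c| + 1) := by gcongr
    _ = η := by field_simp; ring

end Whp

/-! ### Step-up tests in terms of counts, and estimators blind to small p-values. -/

section StepUp

variable {m : ℕ}

/-- Number of `i ∈ s` with `q i ≤ t`. -/
noncomputable def countLE (s : Finset (Fin m)) (q : Fin m → ℝ) (t : ℝ) : ℕ :=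
  (s.filter fun i => q i ≤ t).card

theorem empCDF_eq (s : Finset (Fin m)) (q : Fin m → ℝ) (t : ℝ) :
    empCDF s q t = (countLE s q t : ℝ) / (s.card : ℝ) := rfl

theorem countLE_le_card (s : Finset (Fin m)) (q : Fin m → ℝ) (t : ℝ) :
    countLE s q t ≤ s.card :=
  Finset.card_filter_le _ _

theorem countLE_univ_le (q : Fin m → ℝ) (t : ℝ) : countLE Finset.univ q t ≤ m := by
  simpa using countLE_le_card Finset.univ q t

theorem countLE_mono_set {s s' : Finset (Fin m)} (h : s ⊆ s') (q : Fin m → ℝ) (t : ℝ) :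
    countLE s q t ≤ countLE s' q t :=
  Finset.card_le_card (Finset.filter_subset_filter _ h)

theorem countLE_mono (s : Finset (Fin m)) {q q' : Fin m → ℝ} {t t' : ℝ}
    (hq : ∀ i, q' i ≤ q i) (ht : t ≤ t') : countLE s q t ≤ countLE s q' t' :=
  Finset.card_le_card fun i hi => by
    rw [Finset.mem_filter] at hi ⊢
    exact ⟨hi.1, (hq i).trans (hi.2.trans ht)⟩

theorem countLE_add_compl (s : Finset (Fin m)) (q : Fin m → ℝ) (t : ℝ) :
    countLE s q t + countLE sᶜ q t = countLE Finset.univ q t := by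
  unfold countLE
  rw [← Finset.card_union_of_disjoint, ← Finset.filter_union, Finset.union_compl]
  exact Finset.disjoint_filter_filter disjoint_compl_right

theorem countLE_update (s : Finset (Fin m)) {q : Fin m → ℝ} {i : Fin m} {t : ℝ} (ht : 0 ≤ t)
    (hi : q i ≤ t) : countLE s (Function.update q i 0) t = countLE s q t := by
  unfold countLE
  congr 1
  refine Finset.filter_congr fun j _ => ?_
  rcases eq_or_ne j i with rfl | hj
  · simp [ht, hi]
  · simp [hj]

theorem countLE_eq_card_of_le {s : Finset (Fin m)} {q : Fin m → ℝ} {t : ℝ} (h : ∀ i, q i ≤ t) :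
    countLE s q t = s.card := by
  unfold countLE
  rw [Finset.filter_true_of_mem fun i _ => h i]

theorem countLE_eq_sum (s : Finset (Fin m)) (q : Fin m → ℝ) (t : ℝ) :
    (countLE s q t : ℝ) = ∑ i ∈ s, if q i ≤ t then 1 else 0 := by
  simp [countLE]

theorem measurable_countLE {Ω : Type*} [MeasurableSpace Ω] (s : Finset (Fin m))
    {q : Ω → Fin m → ℝ} {t : Ω → ℝ} (hq : Measurable q) (ht : Measurable t) :
    Measurable fun ω => (countLE s (q ω) (t ω) : ℝ) := by
  simp only [countLE_eq_sum]
  refine Finset.measurable_sum _ fun i _ => ?_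
  exact Measurable.ite (measurableSet_le ((measurable_pi_apply i).comp hq) ht)
    measurable_const measurable_const

theorem measurable_empCDF (s : Finset (Fin m)) (t : ℝ) :
    Measurable fun q : Fin m → ℝ => empCDF s q t :=
  (measurable_countLE s measurable_id measurable_const).div_const _

/-- Removes the sorting: from here on step-up tests are handled through `countLE` only. -/
theorem orderStat_le_iff {q : Fin m → ℝ} {i : ℕ} {t : ℝ} (hi : 1 ≤ i) (him : i ≤ m) :
    orderStat q i ≤ t ↔ i ≤ countLE Finset.univ q t := by
  rw [orderStat, dif_pos ⟨hi, him⟩]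
  have h := Tuple.lt_card_le_iff_apply_le_of_monotone (a := t)
    (Tuple.monotone_sort q) (j := ⟨i - 1, by omega⟩)
  rw [Function.comp_apply] at h
  rw [← h]
  have hc : Fintype.card {j // (q ∘ Tuple.sort q) j ≤ t} = countLE Finset.univ q t := by
    rw [countLE, ← Fintype.card_subtype]
    exact Fintype.card_congr ((Tuple.sort q).subtypeEquiv fun a => Iff.rfl)
  rw [← Fintype.card_subtype, hc]
  simp only
  omega

theorem numRej_le (c : ℕ → ℝ) (q : Fin m → ℝ) : numRej c q ≤ m := by
  classical
  exact Nat.findGreatest_le m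

theorem numRej_le_countLE (c : ℕ → ℝ) (q : Fin m → ℝ) :
    numRej c q ≤ countLE Finset.univ q (c (numRej c q)) := by
  classical
  rcases Nat.eq_zero_or_pos (numRej c q) with h | h
  · rw [h]; exact Nat.zero_le _
  · rw [← orderStat_le_iff h (numRej_le c q)]
    exact Nat.findGreatest_of_ne_zero (P := fun i => orderStat q i ≤ c i) rfl h.ne'

theorem le_numRej {c : ℕ → ℝ} {q : Fin m → ℝ} {i : ℕ} (him : i ≤ m)
    (h : i ≤ countLE Finset.univ q (c i)) : i ≤ numRej c q := by
  classical
  rcases Nat.eq_zero_or_pos i with h0 | h0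
  · omega
  · exact Nat.le_findGreatest him ((orderStat_le_iff h0 him).2 h)

/-- The count at the final threshold is itself an admissible index, because the critical values
increase; maximality of `numRej` gives equality. -/
theorem countLE_numRej {c : ℕ → ℝ} (hc : Monotone c) (q : Fin m → ℝ) :
    countLE Finset.univ q (c (numRej c q)) = numRej c q := by
  refine le_antisymm (le_numRej (countLE_univ_le _ _) ?_) (numRej_le_countLE c q)
  exact countLE_mono _ (fun _ => le_rfl) (hc (numRej_le_countLE c q))

theorem numRej_mono {c c' : ℕ → ℝ} {q q' : Fin m → ℝ} (hc : ∀ i ≤ m, c i ≤ c' i)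
    (hq : ∀ i, q' i ≤ q i) : numRej c q ≤ numRej c' q' :=
  le_numRej (numRej_le c q)
    ((numRej_le_countLE c q).trans (countLE_mono _ hq (hc _ (numRej_le c q))))

theorem FDP_nonneg (c : ℕ → ℝ) (q : Fin m → ℝ) (I : Finset (Fin m)) : 0 ≤ FDP c q I := by
  unfold FDP; positivity

theorem FDP_congr {c c' : ℕ → ℝ} (q : Fin m → ℝ) (I : Finset (Fin m))
    (hc : ∀ i ≤ m, c i = c' i) : FDP c q I = FDP c' q I := by
  have h : numRej c q = numRej c' q :=
    le_antisymm (numRej_mono (fun i hi => (hc i hi).le) fun _ => le_rfl)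
      (numRej_mono (fun i hi => (hc i hi).ge) fun _ => le_rfl)
  rw [FDP, FDP, numFalseRej, numFalseRej, h, hc _ (numRej_le c' q)]

/-- A p-value below the threshold of the modified vector is counted there before and after the
change, so the same index stays admissible for `q`. The reverse inequality is monotonicity in the
p-values. -/
theorem numRej_update {c : ℕ → ℝ} (hc : Monotone c) (hc0 : 0 ≤ c 0) {q : Fin m → ℝ} {i : Fin m}
    (hq : 0 ≤ q i) (h : q i ≤ c (numRej c (Function.update q i 0))) :
    numRej c (Function.update q i 0) = numRej c q := by
  refine le_antisymm (le_numRej (numRej_le _ _) ?_) (numRej_mono (fun _ _ => le_rfl) fun j => ?_)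
  · rw [← countLE_update Finset.univ (hc0.trans (hc (Nat.zero_le _))) h]
    exact numRej_le_countLE _ _
  · rcases eq_or_ne j i with rfl | hj
    · simpa using hq
    · simp [hj]

theorem critAdaptive_monotone {α l M : ℝ} (hα : 0 ≤ α) (hM : 0 ≤ M) :
    Monotone (critAdaptive α l M) := by
  intro i j hij
  unfold critAdaptive
  gcongr

theorem critAdaptive_zero {α l M : ℝ} (hl : 0 ≤ l) : critAdaptive α l M 0 = 0 := by
  simp [critAdaptive, hl]

/-- Estimators of the number of true nulls for which the step-up test with critical values
`min (i α / M) l` admits exact moment formulas: `M` does not depend on the position of `p`-values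
below `l`. -/
structure NullEstimator (α l : ℝ) (M : (Fin m → ℝ) → ℝ) : Prop where
  alpha_pos : 0 < α
  cap_pos : 0 < l
  cap_le : l ≤ 1
  measurable : Measurable M
  one_le : ∀ q, 1 ≤ M q
  le_apply : ∀ q, α / l * countLE Finset.univ q l ≤ M q
  apply_update : ∀ q i, q i ≤ l → M (Function.update q i 0) = M q

/-- Rejections of the step-up test with critical values `min (i α / M q) l`. -/
noncomputable def adaptiveRej (α l : ℝ) (M : (Fin m → ℝ) → ℝ) (q : Fin m → ℝ) : ℕ :=
  numRej (critAdaptive α l (M q)) q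

/-- Rejection threshold of the step-up test with critical values `min (i α / M q) l`. -/
noncomputable def adaptiveThr (α l : ℝ) (M : (Fin m → ℝ) → ℝ) (q : Fin m → ℝ) : ℝ :=
  critAdaptive α l (M q) (adaptiveRej α l M q)

theorem adaptiveThr_le (α l : ℝ) (M : (Fin m → ℝ) → ℝ) (q : Fin m → ℝ) :
    adaptiveThr α l M q ≤ l :=
  min_le_right _ _

namespace NullEstimator

variable {α l : ℝ} {M : (Fin m → ℝ) → ℝ} (h : NullEstimator α l M)
include h

theorem pos (q : Fin m → ℝ) : 0 < M q := one_pos.trans_le (h.one_le q)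

theorem crit_monotone (q : Fin m → ℝ) : Monotone (critAdaptive α l (M q)) :=
  critAdaptive_monotone h.alpha_pos.le (h.pos q).le

theorem thr_nonneg (q : Fin m → ℝ) : 0 ≤ adaptiveThr α l M q := by
  rw [← critAdaptive_zero (α := α) (M := M q) h.cap_pos.le]
  exact h.crit_monotone q (Nat.zero_le _)

theorem countLE_thr (q : Fin m → ℝ) :
    countLE Finset.univ q (adaptiveThr α l M q) = adaptiveRej α l M q :=
  countLE_numRej (h.crit_monotone q) q

/-- The cap is never active at the final index: R is at most the count at `l`, and `le_apply` gives
`α` times this count at most `l * M q`. -/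
theorem thr_eq (q : Fin m → ℝ) :
    adaptiveThr α l M q = (adaptiveRej α l M q : ℝ) / M q * α := by
  unfold adaptiveThr critAdaptive
  refine min_eq_left ?_
  have h1 : (adaptiveRej α l M q : ℝ) ≤ countLE Finset.univ q l := by
    rw [← h.countLE_thr q]
    exact_mod_cast countLE_mono _ (fun _ => le_rfl) (adaptiveThr_le _ _ _ q)
  have h2 := h.le_apply q
  have hM := h.pos q
  have hl := h.cap_pos
  have hα := h.alpha_pos
  rw [div_mul_eq_mul_div, div_le_iff₀ hM]
  rw [div_mul_eq_mul_div, div_le_iff₀ hl] at h2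
  nlinarith

/-- The left threshold does not involve the `i`-th p-value, so rejection of a true null becomes an
event about a uniform variable and an independent threshold. -/
theorem le_thr_update_iff {q : Fin m → ℝ} {i : Fin m} (hq : 0 ≤ q i) :
    q i ≤ adaptiveThr α l M (Function.update q i 0) ↔ q i ≤ adaptiveThr α l M q := by
  constructor
  · intro hi
    have hM := h.apply_update q i (hi.trans (adaptiveThr_le _ _ _ _))
    unfold adaptiveThr adaptiveRej at hi ⊢
    rw [hM] at hi
    rwa [numRej_update (h.crit_monotone q) (critAdaptive_zero h.cap_pos.le).ge hq hi] at hi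
  · intro hi
    have hM := h.apply_update q i (hi.trans (adaptiveThr_le _ _ _ _))
    unfold adaptiveThr adaptiveRej at hi ⊢
    rw [hM]
    refine hi.trans (h.crit_monotone q (numRej_mono (fun _ _ => le_rfl) fun j => ?_))
    rcases eq_or_ne j i with rfl | hj
    · simpa using hq
    · simp [hj]

theorem rej_update {q : Fin m → ℝ} {i : Fin m} (hq : 0 ≤ q i)
    (hi : q i ≤ adaptiveThr α l M q) :
    adaptiveRej α l M (Function.update q i 0) = adaptiveRej α l M q := by
  have hM := h.apply_update q i (hi.trans (adaptiveThr_le _ _ _ _))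
  have hi' := (h.le_thr_update_iff hq).2 hi
  unfold adaptiveThr adaptiveRej at *
  rw [hM] at hi' ⊢
  exact numRej_update (h.crit_monotone q) (critAdaptive_zero h.cap_pos.le).ge hq hi'

theorem thr_update {q : Fin m → ℝ} {i : Fin m} (hq : 0 ≤ q i)
    (hi : q i ≤ adaptiveThr α l M q) :
    adaptiveThr α l M (Function.update q i 0) = adaptiveThr α l M q := by
  rw [adaptiveThr, h.rej_update hq hi, h.apply_update q i (hi.trans (adaptiveThr_le _ _ _ _)),
    adaptiveThr]

/-- After zeroing a coordinate the denominator of the false discovery proportion is positive, so 0/0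
does not arise when it is cancelled. -/
theorem one_le_rej {q : Fin m → ℝ} {i : Fin m} (hi : q i = 0) : 1 ≤ adaptiveRej α l M q := by
  refine le_numRej i.pos ?_
  rw [Nat.one_le_iff_ne_zero, ← Nat.pos_iff_ne_zero]
  refine Finset.card_pos.2 ⟨i, Finset.mem_filter.2 ⟨Finset.mem_univ _, ?_⟩⟩
  rw [hi, ← critAdaptive_zero (α := α) (M := M q) h.cap_pos.le]
  exact h.crit_monotone q (Nat.zero_le _)

theorem measurable_rej : Measurable fun q => adaptiveRej α l M q := by
  classical
  -- Expressed by counts, the maximal index is measurable without any argument about `Tuple.sort`.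
  have : (fun q => adaptiveRej α l M q) = fun q : Fin m → ℝ =>
      Nat.findGreatest (fun i => i ≤ countLE Finset.univ q (critAdaptive α l (M q) i)) m := by
    funext q
    refine le_antisymm (Nat.le_findGreatest (numRej_le _ _) (numRej_le_countLE _ _)) ?_
    refine le_numRej (Nat.findGreatest_le m) ?_
    exact Nat.findGreatest_spec (P := fun i => i ≤ countLE Finset.univ q
      (critAdaptive α l (M q) i)) (Nat.zero_le m) (Nat.zero_le _)
  rw [this]
  refine measurable_findGreatest fun i _ => ?_
  have h1 : Measurable fun q : Fin m → ℝ =>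
      (countLE Finset.univ q (critAdaptive α l (M q) i) : ℝ) :=
    measurable_countLE _ measurable_id
      (((measurable_const.div h.measurable).mul_const α).min measurable_const)
  have : {q : Fin m → ℝ | i ≤ countLE Finset.univ q (critAdaptive α l (M q) i)} =
      {q : Fin m → ℝ | (i : ℝ) ≤ (countLE Finset.univ q (critAdaptive α l (M q) i) : ℝ)} := by
    ext q; simp
  rw [this]
  exact measurableSet_le measurable_const h1

theorem measurable_rej_cast : Measurable fun q => (adaptiveRej α l M q : ℝ) :=
  measurable_from_nat.comp h.measurable_rej

theorem measurable_thr : Measurable fun q => adaptiveThr α l M q := by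
  simp only [h.thr_eq]
  exact (h.measurable_rej_cast.div h.measurable).mul_const α

end NullEstimator

theorem FDP_critAdaptive (α l : ℝ) (M : (Fin m → ℝ) → ℝ) (q : Fin m → ℝ) (I : Finset (Fin m)) :
    FDP (critAdaptive α l (M q)) q I =
      ∑ i ∈ I, (if q i ≤ adaptiveThr α l M q then 1 else 0) * ((adaptiveRej α l M q : ℝ))⁻¹ := by
  rw [← Finset.sum_mul, ← countLE_eq_sum, ← div_eq_mul_inv]
  rfl

namespace NullEstimator

variable {α l : ℝ} {M : (Fin m → ℝ) → ℝ} (h : NullEstimator α l M)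
include h

theorem measurable_FDP (I : Finset (Fin m)) :
    Measurable fun q => FDP (critAdaptive α l (M q)) q I := by
  simp only [FDP_critAdaptive]
  refine Finset.measurable_sum _ fun i _ => ?_
  exact (Measurable.ite (measurableSet_le (measurable_pi_apply i) h.measurable_thr)
    measurable_const measurable_const).mul h.measurable_rej_cast.inv

theorem FDP_le_one (q : Fin m → ℝ) (I : Finset (Fin m)) :
    FDP (critAdaptive α l (M q)) q I ≤ 1 := by
  refine div_le_one_of_le₀ ?_ (Nat.cast_nonneg _)
  have := countLE_mono_set (Finset.subset_univ I) q (adaptiveThr α l M q)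
  rw [h.countLE_thr q] at this
  exact_mod_cast this

end NullEstimator

end StepUp

/-! ### Consequences of basic independence. -/

/-- Associativity of product measures. It is applied to one true null, the remaining true nulls, and
the false nulls. -/
theorem indepFun_prodMk_of_indepFun {Ω A B C : Type*} [MeasurableSpace Ω] [MeasurableSpace A]
    [MeasurableSpace B] [MeasurableSpace C] {P : Measure Ω} [IsProbabilityMeasure P]
    {X : Ω → A} {Y : Ω → B} {Z : Ω → C} (hX : Measurable X) (hY : Measurable Y)
    (hZ : Measurable Z) (hXY : IndepFun X Y P) (hXYZ : IndepFun (fun ω => (X ω, Y ω)) Z P) :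
    IndepFun X (fun ω => (Y ω, Z ω)) P := by
  have hYZ : IndepFun Y Z P := hXYZ.comp measurable_snd measurable_id
  have : IsProbabilityMeasure (P.map X) := Measure.isProbabilityMeasure_map hX.aemeasurable
  have : IsProbabilityMeasure (P.map Y) := Measure.isProbabilityMeasure_map hY.aemeasurable
  have : IsProbabilityMeasure (P.map Z) := Measure.isProbabilityMeasure_map hZ.aemeasurable
  rw [indepFun_iff_map_prod_eq_prod_map_map (by fun_prop) (by fun_prop)] at hXY hXYZ hYZ ⊢
  rw [hYZ, ← Measure.prodAssoc_prod, ← hXY, ← hXYZ, Measure.map_map (by fun_prop) (by fun_prop)]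
  rfl

namespace BasicIndependence

variable {Ω : Type*} [MeasurableSpace Ω] {P : Measure Ω} [IsProbabilityMeasure P] {m : ℕ}
  {p : Ω → Fin m → ℝ} {I : Finset (Fin m)} (h : BasicIndependence P p I)
include h

omit [IsProbabilityMeasure P] in
theorem measurable_fun : Measurable p := measurable_pi_lambda _ h.measurable

/-- The `p`-value of a true null is independent of all other `p`-values. -/
theorem indepFun_update {i : Fin m} (hi : i ∈ I) :
    IndepFun (fun ω => p ω i) (fun ω => Function.update (p ω) i 0) P := by
  classical
  let i' : {i // i ∈ I} := ⟨i, hi⟩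
  let S : Finset {i // i ∈ I} := {i'}
  let T : Finset {i // i ∈ I} := Finset.univ.erase i'
  have hST : Disjoint S T := by
    rw [Finset.disjoint_singleton_left]
    exact Finset.notMem_erase _ _
  have hm := h.measurable
  have h1 := h.indep_true.indepFun_finset S T hST fun j => h.measurable j
  have h2 : IndepFun (fun ω => ((fun (j : S) => p ω (j : {i // i ∈ I})),
      (fun (j : T) => p ω (j : {i // i ∈ I})))) (fun ω (j : {j // j ∉ I}) => p ω j) P :=
    h.indep_true_false.comp (φ := fun f => ((fun j : S => f j), (fun j : T => f j))) (ψ := id)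
      (by fun_prop) measurable_id
  have h3 := indepFun_prodMk_of_indepFun (by fun_prop) (by fun_prop) (by fun_prop) h1 h2
  let ψ : (T → ℝ) × ({j // j ∉ I} → ℝ) → Fin m → ℝ := fun f j =>
    if hj : j = i then (0 : ℝ) else
      if hj' : j ∈ I then f.1 ⟨⟨j, hj'⟩, Finset.mem_erase.2
        ⟨fun e => hj (congrArg Subtype.val e), Finset.mem_univ _⟩⟩ else f.2 ⟨j, hj'⟩
  have hφ : Measurable fun f : S → ℝ => f ⟨i', Finset.mem_singleton_self _⟩ :=
    measurable_pi_apply _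
  have hψ : Measurable ψ := by
    refine measurable_pi_lambda _ fun j => ?_
    by_cases hj : j = i
    · simp only [ψ, hj, dite_true]; exact measurable_const
    · by_cases hj' : j ∈ I
      · simp only [ψ, hj, hj', dite_true, dite_false]; fun_prop
      · simp only [ψ, hj, hj', dite_false]; fun_prop
  have h4 := h3.comp hφ hψ
  have heq : (fun ω => Function.update (p ω) i 0) =
      ψ ∘ fun ω => ((fun j : T => p ω (j : {i // i ∈ I})), fun j : {j // j ∉ I} => p ω j) := by
    funext ω j
    simp only [Function.comp_apply, ψ]
    rcases eq_or_ne j i with rfl | hj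
    · simp
    · by_cases hj' : j ∈ I <;> simp [hj, hj']
  rw [heq]
  exact h4

omit [IsProbabilityMeasure P] in
theorem measureReal_le {i : Fin m} (hi : i ∈ I) {x : ℝ} (hx : x ∈ Set.Icc (0 : ℝ) 1) :
    P.real {ω | p ω i ≤ x} = x := by
  rw [Measure.real, h.uniform_true i hi x hx, ENNReal.toReal_ofReal hx.1]

theorem integrable_comp {f : (Fin m → ℝ) → ℝ} (hf : Measurable f) {B : ℝ}
    (hB : ∀ q, |f q| ≤ B) : Integrable (fun ω => f (p ω)) P :=
  Integrable.of_bound (hf.comp h.measurable_fun).aestronglyMeasurable B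
    (ae_of_all _ fun ω => hB (p ω))

/-- Integrating out the `p`-value of a true null. -/
theorem integral_ite_le_mul {i : Fin m} (hi : i ∈ I) {θ g : (Fin m → ℝ) → ℝ}
    (hθ : Measurable θ) (hg : Measurable g) (hθ' : ∀ q, θ q ∈ Set.Icc (0 : ℝ) 1) {B : ℝ}
    (hB : ∀ q, |g q| ≤ B) :
    ∫ ω, (if p ω i ≤ θ (Function.update (p ω) i 0) then 1 else 0) *
        g (Function.update (p ω) i 0) ∂P =
      ∫ ω, θ (Function.update (p ω) i 0) * g (Function.update (p ω) i 0) ∂P := by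
  have hX : Measurable fun ω => p ω i := h.measurable i
  have hY : Measurable fun ω => Function.update (p ω) i 0 :=
    measurable_update_left.comp h.measurable_fun
  have hind := (indepFun_iff_map_prod_eq_prod_map_map hX.aemeasurable hY.aemeasurable).1
    (h.indepFun_update hi)
  have hpX : IsProbabilityMeasure (P.map fun ω => p ω i) :=
    Measure.isProbabilityMeasure_map hX.aemeasurable
  have hpY : IsProbabilityMeasure (P.map fun ω => Function.update (p ω) i 0) :=
    Measure.isProbabilityMeasure_map hY.aemeasurable
  let F : ℝ × (Fin m → ℝ) → ℝ := fun x => (if x.1 ≤ θ x.2 then 1 else 0) * g x.2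
  have hF : Measurable F :=
    (Measurable.ite (measurableSet_le measurable_fst (hθ.comp measurable_snd))
      measurable_const measurable_const).mul (hg.comp measurable_snd)
  have hFB : ∀ x, ‖F x‖ ≤ |B| := by
    intro x
    simp only [F, norm_mul, Real.norm_eq_abs]
    have h1 : |(if x.1 ≤ θ x.2 then (1 : ℝ) else 0)| ≤ 1 := by split_ifs <;> simp
    have h2 := (hB x.2).trans (le_abs_self B)
    calc _ ≤ 1 * |B| := by gcongr
      _ = _ := one_mul _
  calc ∫ ω, (if p ω i ≤ θ (Function.update (p ω) i 0) then 1 else 0) *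
        g (Function.update (p ω) i 0) ∂P
      = ∫ x, F x ∂(P.map fun ω => (p ω i, Function.update (p ω) i 0)) := by
        rw [integral_map (hX.prodMk hY).aemeasurable hF.aestronglyMeasurable]
    _ = ∫ y, ∫ u, F (u, y) ∂(P.map fun ω => p ω i)
          ∂(P.map fun ω => Function.update (p ω) i 0) := by
        rw [hind, integral_prod_symm]
        exact Integrable.of_bound hF.aestronglyMeasurable |B| (ae_of_all _ hFB)
    _ = ∫ y, θ y * g y ∂(P.map fun ω => Function.update (p ω) i 0) := by
        refine integral_congr_ae (ae_of_all _ fun y => ?_)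
        simp only [F]
        rw [integral_mul_const]
        congr 1
        have : (fun u : ℝ => if u ≤ θ y then (1 : ℝ) else 0) =
            (Set.Iic (θ y)).indicator fun _ => 1 := by
          funext u; simp [Set.indicator_apply]
        rw [this, integral_indicator measurableSet_Iic, setIntegral_const, smul_eq_mul, mul_one,
          map_measureReal_apply hX measurableSet_Iic]
        exact h.measureReal_le hi (hθ' y)
    _ = _ := by
        exact integral_map hY.aemeasurable (hθ.mul hg).aestronglyMeasurable

/-- A correlation inequality: a large p-value favours an increasing event. Let a be the probability
of `S` with coordinate `i` replaced by `s`. Since `S` is increasing, its part with p-value at most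
`s` has probability at most s·a, and the other part at least (1 - s)·a. -/
theorem mul_measureReal_le_inter {i : Fin m} (hi : i ∈ I) {s : ℝ} (hs : s ∈ Set.Icc (0 : ℝ) 1)
    {S : Set (Fin m → ℝ)} (hS : MeasurableSet S)
    (hup : ∀ q q' : Fin m → ℝ, (∀ j, q j ≤ q' j) → q ∈ S → q' ∈ S) :
    (1 - s) * P.real {ω | p ω ∈ S} ≤ P.real {ω | p ω ∈ S ∧ s < p ω i} := by
  let S' : Set (Fin m → ℝ) := {q | Function.update q i s ∈ S}
  have hS' : MeasurableSet S' := measurable_update_left hS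
  have hpre : ∀ ω, Function.update (p ω) i 0 ∈ S' ↔ Function.update (p ω) i s ∈ S := fun ω => by
    simp [S']
  have hind : ∀ T : Set ℝ, MeasurableSet T →
      P.real {ω | p ω i ∈ T ∧ Function.update (p ω) i s ∈ S} =
        P.real {ω | p ω i ∈ T} * P.real {ω | Function.update (p ω) i s ∈ S} := by
    intro T hT
    have := (h.indepFun_update hi).measure_inter_preimage_eq_mul T S' hT hS'
    simp only [Measure.real]
    rw [← ENNReal.toReal_mul]
    congr 1
    simpa only [Set.preimage, hpre, Set.inter_def, Set.mem_ofPred_eq] using this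
  have h1 : P.real {ω | p ω ∈ S ∧ p ω i ≤ s} ≤
      s * P.real {ω | Function.update (p ω) i s ∈ S} := by
    have := hind (Set.Iic s) measurableSet_Iic
    simp only [Set.mem_Iic] at this
    rw [h.measureReal_le hi hs] at this
    rw [← this]
    refine measureReal_mono fun ω hω => ⟨hω.2, hup _ _ (fun j => ?_) hω.1⟩
    rcases eq_or_ne j i with rfl | hj
    · simpa using hω.2
    · simp [hj]
  have hgt : P.real {ω | s < p ω i} = 1 - s := by
    have := probReal_compl_eq_one_sub (μ := P) (s := {ω | p ω i ≤ s})
      (measurableSet_le (h.measurable i) measurable_const)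
    rw [h.measureReal_le hi hs] at this
    rw [← this]
    congr 1
    ext ω
    simp
  have h2 : (1 - s) * P.real {ω | Function.update (p ω) i s ∈ S} ≤
      P.real {ω | p ω ∈ S ∧ s < p ω i} := by
    have := hind (Set.Ioi s) measurableSet_Ioi
    simp only [Set.mem_Ioi] at this
    rw [hgt] at this
    rw [← this]
    refine measureReal_mono fun ω hω => ⟨hup _ _ (fun j => ?_) hω.2, hω.1⟩
    rcases eq_or_ne j i with rfl | hj
    · simpa using hω.1.le
    · simp [hj]
  have h3 : P.real {ω | p ω ∈ S} =
      P.real {ω | p ω ∈ S ∧ p ω i ≤ s} + P.real {ω | p ω ∈ S ∧ s < p ω i} := by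
    rw [← measureReal_inter_add_sdiff (μ := P) (s := {ω | p ω ∈ S})
      (measurableSet_le (h.measurable i) measurable_const : MeasurableSet {ω | p ω i ≤ s})]
    congr 2
    ext ω
    simp
  rw [h3]
  nlinarith [hs.1, hs.2]

/-- A lower bound for the probability that, in addition to an increasing event, all `p`-values of
a set of true nulls exceed `s`. -/
theorem pow_mul_measureReal_le_inter {s : ℝ} (hs : s ∈ Set.Icc (0 : ℝ) 1)
    {S : Set (Fin m → ℝ)} (hS : MeasurableSet S)
    (hup : ∀ q q' : Fin m → ℝ, (∀ j, q j ≤ q' j) → q ∈ S → q' ∈ S) {J : Finset (Fin m)}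
    (hJ : J ⊆ I) :
    (1 - s) ^ J.card * P.real {ω | p ω ∈ S} ≤ P.real {ω | p ω ∈ S ∧ ∀ j ∈ J, s < p ω j} := by
  classical
  induction J using Finset.induction_on with
  | empty => simp
  | insert i J hi ih =>
    have hi' : i ∈ I := hJ (Finset.mem_insert_self _ _)
    have ih' := ih ((Finset.subset_insert _ _).trans hJ)
    have hmS : MeasurableSet {q : Fin m → ℝ | q ∈ S ∧ ∀ j ∈ J, s < q j} := by
      refine hS.inter ?_
      have : {q : Fin m → ℝ | ∀ j ∈ J, s < q j} = ⋂ j ∈ J, {q | s < q j} := by ext; simp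
      change MeasurableSet {q : Fin m → ℝ | ∀ j ∈ J, s < q j}
      rw [this]
      exact Finset.measurableSet_biInter _ fun j _ =>
        measurableSet_lt measurable_const (measurable_pi_apply j)
    have key := h.mul_measureReal_le_inter hi' hs hmS
      (fun q q' hq hqS => ⟨hup q q' hq hqS.1, fun j hj => (hqS.2 j hj).trans_le (hq j)⟩)
    have heq : {ω | p ω ∈ {q : Fin m → ℝ | q ∈ S ∧ ∀ j ∈ J, s < q j} ∧ s < p ω i} =
        {ω | p ω ∈ S ∧ ∀ j ∈ insert i J, s < p ω j} := by
      ext ω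
      simp only [Set.mem_ofPred_eq, Finset.forall_mem_insert]
      tauto
    rw [heq] at key
    refine le_trans ?_ key
    rw [Finset.card_insert_of_notMem hi, pow_succ']
    rw [mul_assoc]
    exact mul_le_mul_of_nonneg_left ih' (sub_nonneg.2 hs.2)

/-- Chebyshev's inequality for the number of true nulls with `p`-value at most `t`. -/
theorem measure_le_abs_countLE_sub {t x : ℝ} (ht : t ∈ Set.Icc (0 : ℝ) 1) (hx : 0 < x) :
    P {ω | x ≤ |(countLE I (p ω) t : ℝ) - I.card * t|} ≤
      ENNReal.ofReal ((I.card : ℝ) * t / x ^ 2) := by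
  let X : Fin m → Ω → ℝ := fun i ω => if p ω i ≤ t then 1 else 0
  have hXm : ∀ i, Measurable (X i) := fun i =>
    Measurable.ite (measurableSet_le (h.measurable i) measurable_const)
      measurable_const measurable_const
  have hXL : ∀ i, MemLp (X i) 2 P := fun i =>
    MemLp.of_bound (hXm i).aestronglyMeasurable 1 (ae_of_all _ fun ω => by
      simp only [X]; split_ifs <;> simp)
  have hX1 : ∀ i ∈ I, ∫ ω, X i ω ∂P = t := by
    intro i hi
    have : X i = {ω | p ω i ≤ t}.indicator fun _ => 1 := by
      funext ω; simp [X, Set.indicator_apply]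
    rw [this, integral_indicator (measurableSet_le (h.measurable i) measurable_const),
      setIntegral_const, smul_eq_mul, mul_one, h.measureReal_le hi ht]
  have hXX : ∀ i, X i ^ 2 = X i := fun i => by
    funext ω; simp only [X, Pi.pow_apply]; split_ifs <;> simp
  have hvar : ∀ i ∈ I, variance (X i) P ≤ t := by
    intro i hi
    -- An indicator equals its square, so its second moment is its mean `t`.
    refine (variance_le_expectation_sq (hXm i).aestronglyMeasurable).trans ?_
    rw [hXX, hX1 i hi]
  have hpair : Set.Pairwise (I : Set (Fin m)) fun i j => IndepFun (X i) (X j) P := by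
    intro i hi j hj hij
    have hne : (⟨i, hi⟩ : {i // i ∈ I}) ≠ ⟨j, hj⟩ := fun e => hij (congrArg Subtype.val e)
    have hφ : Measurable fun u : ℝ => if u ≤ t then (1 : ℝ) else 0 :=
      Measurable.ite measurableSet_Iic measurable_const measurable_const
    exact (h.indep_true.indepFun hne).comp hφ hφ
  have hsum : ∀ ω, (countLE I (p ω) t : ℝ) = (∑ i ∈ I, X i) ω := fun ω => by
    rw [countLE_eq_sum, Finset.sum_apply]
  have hL : MemLp (∑ i ∈ I, X i) 2 P := memLp_finsetSum' I fun i _ => hXL i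
  have hE : ∫ ω, (∑ i ∈ I, X i) ω ∂P = I.card * t := by
    simp only [Finset.sum_apply]
    rw [integral_finsetSum _ fun i _ => (hXL i).integrable (by norm_num),
      Finset.sum_congr rfl hX1]
    simp
  have hch := meas_ge_le_variance_div_sq hL hx
  rw [hE, IndepFun.variance_sum (fun i _ => hXL i) hpair] at hch
  simp only [hsum]
  refine hch.trans (ENNReal.ofReal_le_ofReal ?_)
  gcongr
  calc _ ≤ ∑ i ∈ I, t := Finset.sum_le_sum hvar
    _ = _ := by simp

end BasicIndependence

/-! ### First and second moments of the false discovery proportion. -/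

section Moments

variable {m : ℕ}

/-- The fraction `α V(l) / (l M)`, which has the same mean as the false discovery proportion. -/
noncomputable def nullFraction (α l : ℝ) (M : (Fin m → ℝ) → ℝ) (I : Finset (Fin m))
    (q : Fin m → ℝ) : ℝ :=
  α / l * ((countLE I q l : ℝ) / M q)

/-- Contribution of the `i`-th `p`-value to `V(l) / M`. -/
noncomputable def nullTerm (l : ℝ) (M : (Fin m → ℝ) → ℝ) (i : Fin m) (q : Fin m → ℝ) : ℝ :=
  (if q i ≤ l then 1 else 0) * (M q)⁻¹

/-- Contribution of the `i`-th `p`-value to the false discovery proportion. -/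
noncomputable def rejTerm (α l : ℝ) (M : (Fin m → ℝ) → ℝ) (i : Fin m) (q : Fin m → ℝ) : ℝ :=
  (if q i ≤ adaptiveThr α l M q then 1 else 0) * ((adaptiveRej α l M q : ℝ))⁻¹

theorem nullFraction_eq_sum (α l : ℝ) (M : (Fin m → ℝ) → ℝ) (I : Finset (Fin m))
    (q : Fin m → ℝ) : nullFraction α l M I q = α / l * ∑ i ∈ I, nullTerm l M i q := by
  simp only [nullFraction, nullTerm]
  rw [← Finset.sum_mul, ← countLE_eq_sum, ← div_eq_mul_inv]

theorem natCast_inv_le_one (n : ℕ) : ((n : ℝ))⁻¹ ≤ 1 := Nat.cast_inv_le_one n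

theorem ite_mem_Icc (a : Prop) [Decidable a] : (if a then (1 : ℝ) else 0) ∈ Set.Icc (0 : ℝ) 1 := by
  split_ifs <;> simp

theorem mul_mem_Icc {a b : ℝ} (ha : a ∈ Set.Icc (0 : ℝ) 1) (hb : b ∈ Set.Icc (0 : ℝ) 1) :
    a * b ∈ Set.Icc (0 : ℝ) 1 :=
  ⟨mul_nonneg ha.1 hb.1, mul_le_one₀ ha.2 hb.1 hb.2⟩

theorem abs_le_one_of_mem_Icc {a : ℝ} (ha : a ∈ Set.Icc (0 : ℝ) 1) : |a| ≤ 1 :=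
  abs_le.2 ⟨by linarith [ha.1], ha.2⟩

theorem rejTerm_mem_Icc (α l : ℝ) (M : (Fin m → ℝ) → ℝ) (i : Fin m) (q : Fin m → ℝ) :
    rejTerm α l M i q ∈ Set.Icc (0 : ℝ) 1 :=
  mul_mem_Icc (ite_mem_Icc _) ⟨by positivity, natCast_inv_le_one _⟩

namespace NullEstimator

variable {α l : ℝ} {M : (Fin m → ℝ) → ℝ} (hM : NullEstimator α l M)
include hM

theorem inv_mem_Icc (q : Fin m → ℝ) : (M q)⁻¹ ∈ Set.Icc (0 : ℝ) 1 :=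
  ⟨inv_nonneg.2 (hM.pos q).le, inv_le_one_of_one_le₀ (hM.one_le q)⟩

theorem nullTerm_mem_Icc (i : Fin m) (q : Fin m → ℝ) : nullTerm l M i q ∈ Set.Icc (0 : ℝ) 1 :=
  mul_mem_Icc (ite_mem_Icc _) (hM.inv_mem_Icc q)

theorem measurable_rejTerm (i : Fin m) : Measurable (rejTerm α l M i) :=
  (Measurable.ite (measurableSet_le (measurable_pi_apply i) hM.measurable_thr)
    measurable_const measurable_const).mul hM.measurable_rej_cast.inv

theorem measurable_nullTerm (i : Fin m) : Measurable (nullTerm l M i) :=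
  (Measurable.ite (measurableSet_le (measurable_pi_apply i) measurable_const)
    measurable_const measurable_const).mul hM.measurable.inv

theorem measurable_nullFraction (I : Finset (Fin m)) : Measurable (nullFraction α l M I) :=
  ((measurable_countLE I measurable_id measurable_const).div hM.measurable).const_mul _

theorem nullFraction_mem_Icc (I : Finset (Fin m)) (q : Fin m → ℝ) :
    nullFraction α l M I q ∈ Set.Icc (0 : ℝ) 1 := by
  have h1 := hM.le_apply q
  have h2 : (countLE I q l : ℝ) ≤ countLE Finset.univ q l := by
    exact_mod_cast countLE_mono_set (Finset.subset_univ I) q l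
  have h3 := hM.pos q
  have h4 : 0 < α / l := div_pos hM.alpha_pos hM.cap_pos
  refine ⟨by unfold nullFraction; positivity, ?_⟩
  unfold nullFraction
  rw [← mul_div_assoc, div_le_one h3]
  exact (mul_le_mul_of_nonneg_left h2 h4.le).trans h1

theorem thr_mem_Icc (q : Fin m → ℝ) : adaptiveThr α l M q ∈ Set.Icc (0 : ℝ) 1 :=
  ⟨hM.thr_nonneg q, (adaptiveThr_le _ _ _ q).trans hM.cap_le⟩

theorem cap_mem_Icc : l ∈ Set.Icc (0 : ℝ) 1 := ⟨hM.cap_pos.le, hM.cap_le⟩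

theorem thr_mul_inv_rej {q : Fin m → ℝ} {i : Fin m} (hi : q i = 0) :
    adaptiveThr α l M q * ((adaptiveRej α l M q : ℝ))⁻¹ = α * (M q)⁻¹ := by
  have h1 : (adaptiveRej α l M q : ℝ) ≠ 0 := by
    have := hM.one_le_rej hi
    positivity
  rw [hM.thr_eq]
  field_simp

theorem rejTerm_eq_update {q : Fin m → ℝ} {i : Fin m} (hq : 0 ≤ q i) :
    rejTerm α l M i q = (if q i ≤ adaptiveThr α l M (Function.update q i 0) then 1 else 0) *
      ((adaptiveRej α l M (Function.update q i 0) : ℝ))⁻¹ := by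
  unfold rejTerm
  by_cases hi : q i ≤ adaptiveThr α l M q
  · rw [if_pos hi, if_pos ((hM.le_thr_update_iff hq).2 hi), hM.rej_update hq hi]
  · rw [if_neg hi, if_neg (mt (hM.le_thr_update_iff hq).1 hi), zero_mul, zero_mul]

theorem nullTerm_eq_update {q : Fin m → ℝ} {i : Fin m} :
    nullTerm l M i q = (if q i ≤ l then 1 else 0) * (M (Function.update q i 0))⁻¹ := by
  unfold nullTerm
  by_cases hi : q i ≤ l
  · rw [hM.apply_update q i hi]
  · rw [if_neg hi, zero_mul, zero_mul]

theorem rejTerm_mul_rejTerm_eq_update {q : Fin m → ℝ} {i j : Fin m} (hij : i ≠ j)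
    (hq : 0 ≤ q i) :
    rejTerm α l M i q * rejTerm α l M j q =
      (if q i ≤ adaptiveThr α l M (Function.update q i 0) then 1 else 0) *
      (((adaptiveRej α l M (Function.update q i 0) : ℝ))⁻¹ *
        rejTerm α l M j (Function.update q i 0)) := by
  rw [hM.rejTerm_eq_update hq]
  by_cases hi : q i ≤ adaptiveThr α l M q
  · unfold rejTerm
    rw [hM.thr_update hq hi, hM.rej_update hq hi, Function.update_of_ne hij.symm]
    ring
  · rw [if_neg (mt (hM.le_thr_update_iff hq).1 hi), zero_mul, zero_mul, zero_mul]

theorem nullTerm_mul_nullTerm_eq_update {q : Fin m → ℝ} {i j : Fin m} (hij : i ≠ j) :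
    nullTerm l M i q * nullTerm l M j q = (if q i ≤ l then 1 else 0) *
      ((M (Function.update q i 0))⁻¹ * nullTerm l M j (Function.update q i 0)) := by
  rw [hM.nullTerm_eq_update]
  by_cases hi : q i ≤ l
  · unfold nullTerm
    rw [hM.apply_update q i hi, Function.update_of_ne hij.symm]
    ring
  · rw [if_neg hi, zero_mul, zero_mul, zero_mul]

variable {Ω : Type*} [MeasurableSpace Ω] {P : Measure Ω} [IsProbabilityMeasure P]
  {p : Ω → Fin m → ℝ} {I : Finset (Fin m)}

/-- With Y the p-values after zeroing coordinate `i`, integrating that coordinate out gives `α`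
E(1/M(Y)) on the left, by `thr_mul_inv_rej`, and `l` E(1/M(Y)) for `nullTerm`. -/
theorem integral_rejTerm (h : BasicIndependence P p I) {i : Fin m} (hi : i ∈ I) :
    ∫ ω, rejTerm α l M i (p ω) ∂P = α / l * ∫ ω, nullTerm l M i (p ω) ∂P := by
  have h1 := h.integral_ite_le_mul hi hM.measurable_thr hM.measurable_rej_cast.inv
    hM.thr_mem_Icc (B := 1) fun q => abs_le_one_of_mem_Icc
      ⟨inv_nonneg.2 (Nat.cast_nonneg _), natCast_inv_le_one _⟩
  have h2 := h.integral_ite_le_mul hi (measurable_const (a := l)) hM.measurable.inv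
    (fun _ => hM.cap_mem_Icc) (B := 1) fun q => abs_le_one_of_mem_Icc (hM.inv_mem_Icc q)
  have hl := hM.cap_pos.ne'
  simp only [Pi.inv_apply] at h1 h2
  simp only [fun ω => hM.rejTerm_eq_update (h.mem_Icc ω i).1, hM.nullTerm_eq_update]
  rw [h1, h2]
  simp only [fun ω => hM.thr_mul_inv_rej (q := Function.update (p ω) i 0) (i := i) (by simp)]
  rw [integral_const_mul, integral_const_mul]
  field_simp

/-- The one-coordinate argument applied twice: each integration produces `α` on the rejection side
and `l` on the other, with the same remaining integrand 1/M² at the vector with both coordinates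
zeroed. -/
theorem integral_rejTerm_mul_rejTerm (h : BasicIndependence P p I) {i j : Fin m} (hi : i ∈ I)
    (hj : j ∈ I) (hij : i ≠ j) :
    ∫ ω, rejTerm α l M i (p ω) * rejTerm α l M j (p ω) ∂P =
      (α / l) ^ 2 * ∫ ω, nullTerm l M i (p ω) * nullTerm l M j (p ω) ∂P := by
  have hl := hM.cap_pos.ne'
  have hR : ∀ q, ((adaptiveRej α l M q : ℝ))⁻¹ ∈ Set.Icc (0 : ℝ) 1 := fun q =>
    ⟨inv_nonneg.2 (Nat.cast_nonneg _), natCast_inv_le_one _⟩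
  have hupd : Measurable fun q : Fin m → ℝ => Function.update q i 0 := measurable_update_left
  have hcomm : ∀ q : Fin m → ℝ, Function.update (Function.update q i 0) j 0 =
      Function.update (Function.update q j 0) i 0 := fun q => Function.update_comm hij _ _ q
  -- integrate out the `i`-th coordinate
  have h1 := h.integral_ite_le_mul hi hM.measurable_thr
    (hM.measurable_rej_cast.inv.mul (hM.measurable_rejTerm j)) hM.thr_mem_Icc (B := 1)
    fun q => abs_le_one_of_mem_Icc (mul_mem_Icc (hR q) (rejTerm_mem_Icc α l M j q))
  have h2 := h.integral_ite_le_mul hi (measurable_const (a := l))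
    (hM.measurable.inv.mul (hM.measurable_nullTerm j)) (fun _ => hM.cap_mem_Icc) (B := 1)
    fun q => abs_le_one_of_mem_Icc (mul_mem_Icc (hM.inv_mem_Icc q) (hM.nullTerm_mem_Icc j q))
  -- integrate out the `j`-th coordinate
  have h3 := h.integral_ite_le_mul hj (hM.measurable_thr.comp hupd)
    (((hM.measurable.inv.comp hupd)).mul (hM.measurable_rej_cast.inv.comp hupd))
    (fun q => hM.thr_mem_Icc _) (B := 1)
    fun q => abs_le_one_of_mem_Icc (mul_mem_Icc (hM.inv_mem_Icc _) (hR _))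
  have h4 := h.integral_ite_le_mul hj (measurable_const (a := l))
    ((hM.measurable.inv.comp hupd).mul (hM.measurable.inv.comp hupd))
    (fun _ => hM.cap_mem_Icc) (B := 1)
    fun q => abs_le_one_of_mem_Icc (mul_mem_Icc (hM.inv_mem_Icc _) (hM.inv_mem_Icc _))
  simp only [Pi.inv_apply, Pi.mul_apply, Function.comp_apply] at h1 h2 h3 h4
  -- Zeroing coordinate `j` may be inserted in `M` because the indicator forces the `j`-th p-value
  -- below the cap. This brings the integrand into the shape required by `h3`.
  have e1 : ∀ ω, adaptiveThr α l M (Function.update (p ω) i 0) *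
      (((adaptiveRej α l M (Function.update (p ω) i 0) : ℝ))⁻¹ *
        rejTerm α l M j (Function.update (p ω) i 0)) =
      α * ((if p ω j ≤ adaptiveThr α l M (Function.update (Function.update (p ω) j 0) i 0)
        then 1 else 0) * ((M (Function.update (Function.update (p ω) j 0) i 0))⁻¹ *
        ((adaptiveRej α l M (Function.update (Function.update (p ω) j 0) i 0) : ℝ))⁻¹)) := by
    intro ω
    rw [← mul_assoc, hM.thr_mul_inv_rej (i := i) (by simp)]
    have hq : Function.update (p ω) i 0 j = p ω j := Function.update_of_ne hij.symm _ _
    rw [hM.rejTerm_eq_update (by rw [hq]; exact (h.mem_Icc ω j).1), hcomm, hq, ← hcomm]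
    split_ifs with hc
    · rw [hM.apply_update _ j]
      · ring
      · rw [hq]; exact hc.trans (adaptiveThr_le _ _ _ _)
    · simp
  have e2 : ∀ ω, l * ((M (Function.update (p ω) i 0))⁻¹ *
        nullTerm l M j (Function.update (p ω) i 0)) =
      l * ((if p ω j ≤ l then 1 else 0) *
        ((M (Function.update (Function.update (p ω) j 0) i 0))⁻¹ *
        (M (Function.update (Function.update (p ω) j 0) i 0))⁻¹)) := by
    intro ω
    have hq : Function.update (p ω) i 0 j = p ω j := Function.update_of_ne hij.symm _ _
    rw [hM.nullTerm_eq_update, hq, ← hcomm]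
    split_ifs with hc
    · rw [hM.apply_update _ j]
      · ring
      · rw [hq]; exact hc
    · simp
  have e3 : ∀ ω, adaptiveThr α l M (Function.update (Function.update (p ω) j 0) i 0) *
      ((M (Function.update (Function.update (p ω) j 0) i 0))⁻¹ *
        ((adaptiveRej α l M (Function.update (Function.update (p ω) j 0) i 0) : ℝ))⁻¹) =
      α * ((M (Function.update (Function.update (p ω) j 0) i 0))⁻¹ *
        (M (Function.update (Function.update (p ω) j 0) i 0))⁻¹) := by
    intro ω
    rw [mul_left_comm, hM.thr_mul_inv_rej (i := i) (by simp)]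
    ring
  simp only [fun ω => hM.rejTerm_mul_rejTerm_eq_update hij (h.mem_Icc ω i).1,
    hM.nullTerm_mul_nullTerm_eq_update hij]
  rw [h1, h2]
  simp only [e1, e2]
  rw [integral_const_mul, integral_const_mul, h3, h4]
  simp only [e3]
  rw [integral_const_mul, integral_const_mul]
  field_simp

/-- Exact formula for the false discovery rate. -/
theorem integral_FDP (h : BasicIndependence P p I) :
    ∫ ω, FDP (critAdaptive α l (M (p ω))) (p ω) I ∂P =
      ∫ ω, nullFraction α l M I (p ω) ∂P := by
  simp only [nullFraction_eq_sum, FDP_critAdaptive]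
  rw [integral_const_mul, integral_finsetSum, integral_finsetSum, Finset.mul_sum]
  · exact Finset.sum_congr rfl fun i hi => hM.integral_rejTerm h hi
  · exact fun i _ => h.integrable_comp (hM.measurable_nullTerm i)
      fun q => abs_le_one_of_mem_Icc (hM.nullTerm_mem_Icc i q)
  · exact fun i _ => h.integrable_comp (hM.measurable_rejTerm i)
      fun q => abs_le_one_of_mem_Icc (rejTerm_mem_Icc α l M i q)

/-- Second moment bound for the false discovery proportion. -/
theorem integral_FDP_sq_le (h : BasicIndependence P p I) :
    ∫ ω, FDP (critAdaptive α l (M (p ω))) (p ω) I ^ 2 ∂P ≤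
      ∫ ω, ((adaptiveRej α l M (p ω) : ℝ))⁻¹ ∂P + ∫ ω, nullFraction α l M I (p ω) ^ 2 ∂P := by
  classical
  let A : (Fin m → ℝ) → ℝ := fun q =>
    ∑ i ∈ I, ∑ j ∈ I.erase i, rejTerm α l M i q * rejTerm α l M j q
  let B : (Fin m → ℝ) → ℝ := fun q =>
    ∑ i ∈ I, ∑ j ∈ I.erase i, nullTerm l M i q * nullTerm l M j q
  have hsq : ∀ f : Fin m → ℝ, (∑ i ∈ I, f i) ^ 2 =
      ∑ i ∈ I, f i * f i + ∑ i ∈ I, ∑ j ∈ I.erase i, f i * f j := by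
    intro f
    rw [sq, Finset.sum_mul_sum, ← Finset.sum_add_distrib]
    exact Finset.sum_congr rfl fun i hi => (Finset.add_sum_erase I (fun j => f i * f j) hi).symm
  have hrm : ∀ i j, Integrable (fun ω => rejTerm α l M i (p ω) * rejTerm α l M j (p ω)) P :=
    fun i j => h.integrable_comp
      (f := fun q => rejTerm α l M i q * rejTerm α l M j q)
      ((hM.measurable_rejTerm i).mul (hM.measurable_rejTerm j))
      fun q => abs_le_one_of_mem_Icc (mul_mem_Icc (rejTerm_mem_Icc _ _ _ _ _)
        (rejTerm_mem_Icc _ _ _ _ _))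
  have hnm : ∀ i j, Integrable (fun ω => nullTerm l M i (p ω) * nullTerm l M j (p ω)) P :=
    fun i j => h.integrable_comp
      (f := fun q => nullTerm l M i q * nullTerm l M j q)
      ((hM.measurable_nullTerm i).mul (hM.measurable_nullTerm j))
      fun q => abs_le_one_of_mem_Icc (mul_mem_Icc (hM.nullTerm_mem_Icc _ _)
        (hM.nullTerm_mem_Icc _ _))
  have hAi : Integrable (fun ω => A (p ω)) P :=
    integrable_finsetSum _ fun i _ => integrable_finsetSum _ fun j _ => hrm i j
  have hBi : Integrable (fun ω => B (p ω)) P :=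
    integrable_finsetSum _ fun i _ => integrable_finsetSum _ fun j _ => hnm i j
  have hAB : ∫ ω, A (p ω) ∂P = (α / l) ^ 2 * ∫ ω, B (p ω) ∂P := by
    simp only [A, B]
    rw [integral_finsetSum _ fun i _ => integrable_finsetSum _ fun j _ => hrm i j,
      integral_finsetSum _ fun i _ => integrable_finsetSum _ fun j _ => hnm i j, Finset.mul_sum]
    refine Finset.sum_congr rfl fun i hi => ?_
    rw [integral_finsetSum _ fun j _ => hrm i j, integral_finsetSum _ fun j _ => hnm i j,
      Finset.mul_sum]
    refine Finset.sum_congr rfl fun j hj => ?_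
    rw [Finset.mem_erase] at hj
    exact hM.integral_rejTerm_mul_rejTerm h hi hj.2 hj.1.symm
  have hRi : Integrable (fun ω => ((adaptiveRej α l M (p ω) : ℝ))⁻¹) P :=
    h.integrable_comp (f := fun q => ((adaptiveRej α l M q : ℝ))⁻¹) hM.measurable_rej_cast.inv
      (B := 1) fun q => abs_le_one_of_mem_Icc ⟨by positivity, natCast_inv_le_one _⟩
  have hF : ∀ q, FDP (critAdaptive α l (M q)) q I ^ 2 ≤
      ((adaptiveRej α l M q : ℝ))⁻¹ + A q := by
    intro q
    -- On the diagonal the indicator is idempotent, leaving 1/R times the false discovery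
    -- proportion, which is at most one.
    have hdiag : ∑ i ∈ I, rejTerm α l M i q * rejTerm α l M i q ≤
        ((adaptiveRej α l M q : ℝ))⁻¹ := by
      have : ∀ i ∈ I, rejTerm α l M i q * rejTerm α l M i q =
          rejTerm α l M i q * ((adaptiveRej α l M q : ℝ))⁻¹ := by
        intro i _
        unfold rejTerm
        split_ifs <;> simp
      rw [Finset.sum_congr rfl this, ← Finset.sum_mul]
      have h1 := hM.FDP_le_one q I
      rw [FDP_critAdaptive] at h1
      exact mul_le_of_le_one_left (by positivity) h1
    have := hsq fun i => rejTerm α l M i q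
    rw [FDP_critAdaptive]
    change (∑ i ∈ I, rejTerm α l M i q) ^ 2 ≤ _
    rw [this]
    exact add_le_add_left hdiag _
  -- The off-diagonal sum is the full square minus nonnegative diagonal terms.
  have hW : ∀ q, (α / l) ^ 2 * B q ≤ nullFraction α l M I q ^ 2 := by
    intro q
    rw [nullFraction_eq_sum, mul_pow, hsq fun i => nullTerm l M i q]
    refine mul_le_mul_of_nonneg_left ?_ (by positivity)
    exact le_add_of_nonneg_left (Finset.sum_nonneg fun i _ => mul_self_nonneg _)
  have hFi : Integrable (fun ω => FDP (critAdaptive α l (M (p ω))) (p ω) I ^ 2) P :=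
    h.integrable_comp (f := fun q => FDP (critAdaptive α l (M q)) q I ^ 2)
      ((hM.measurable_FDP I).pow_const 2) (B := 1) fun q => abs_le_one_of_mem_Icc
        ⟨by positivity, pow_le_one₀ (FDP_nonneg _ _ _) (hM.FDP_le_one q I)⟩
  have hWi : Integrable (fun ω => nullFraction α l M I (p ω) ^ 2) P :=
    h.integrable_comp (f := fun q => nullFraction α l M I q ^ 2)
      ((hM.measurable_nullFraction I).pow_const 2) (B := 1) fun q => abs_le_one_of_mem_Icc
        ⟨by positivity, pow_le_one₀ (hM.nullFraction_mem_Icc I q).1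
          (hM.nullFraction_mem_Icc I q).2⟩
  calc _ ≤ ∫ ω, (((adaptiveRej α l M (p ω) : ℝ))⁻¹ + A (p ω)) ∂P :=
        integral_mono hFi (hRi.add hAi) fun ω => hF (p ω)
    _ = ∫ ω, ((adaptiveRej α l M (p ω) : ℝ))⁻¹ ∂P + ∫ ω, (α / l) ^ 2 * B (p ω) ∂P := by
        rw [integral_add hRi hAi, hAB, integral_const_mul]
    _ ≤ _ := add_le_add le_rfl (integral_mono (hBi.const_mul _) hWi fun ω => hW (p ω))

end NullEstimator

end Moments

/-! ### Consistency criterion, the BH test, and laws of large numbers for null counts. -/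

section Asymptotics

variable {Ω : ℕ → Type*} [∀ m, MeasurableSpace (Ω m)] {P : ∀ m, Measure (Ω m)}
  [∀ m, IsProbabilityMeasure (P m)] {p : ∀ m, Ω m → Fin m → ℝ} {I₀ : ∀ m, Finset (Fin m)}

/-- Allows inequalities that hold with probability tending to one to be passed to limits. -/
instance whp_neBot : (whp P).NeBot := by
  refine ⟨fun h => ?_⟩
  have h1 : ∀ᶠ _ in whp P, False := by rw [h]; trivial
  rw [eventually_whp_iff] at h1
  simp only [not_false_eq_true, Set.ofPred_true, measure_univ] at h1
  exact one_ne_zero (tendsto_nhds_unique tendsto_const_nhds h1)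

/-- Chebyshev: the variance is at most E(1/R) + E(W²) - (E W)², which tends to 0 + w² - w² by
bounded convergence. -/
theorem consistent_of_tendsto_rej (hBI : ∀ m, BasicIndependence (P m) (p m) (I₀ m)) {α l : ℝ}
    {M : ∀ m, (Fin m → ℝ) → ℝ} (hM : ∀ m, NullEstimator α l (M m)) {w : ℝ}
    (hW : Tendsto (fun x : Σ m, Ω m => nullFraction α l (M x.1) (I₀ x.1) (p x.1 x.2)) (whp P)
      (𝓝 w))
    (hR : Tendsto (fun x : Σ m, Ω m => adaptiveRej α l (M x.1) (p x.1 x.2)) (whp P) atTop) :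
    Consistent P fun m ω => FDP (critAdaptive α l (M m (p m ω))) (p m ω) (I₀ m) := by
  have hpm : ∀ m, Measurable (p m) := fun m => (hBI m).measurable_fun
  have hWi := tendsto_integral_of_tendsto_whp (P := P)
    (fun m => ((hM m).measurable_nullFraction (I₀ m)).comp (hpm m)) (B := 1)
    (fun m ω => abs_le_one_of_mem_Icc ((hM m).nullFraction_mem_Icc _ _)) hW
  have hW2 := tendsto_integral_of_tendsto_whp (P := P)
    (X := fun m ω => nullFraction α l (M m) (I₀ m) (p m ω) ^ 2)
    (fun m => (((hM m).measurable_nullFraction (I₀ m)).comp (hpm m)).pow_const 2) (B := 1)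
    (fun m ω => abs_le_one_of_mem_Icc ⟨by positivity,
      pow_le_one₀ ((hM m).nullFraction_mem_Icc _ _).1 ((hM m).nullFraction_mem_Icc _ _).2⟩)
    (hW.pow 2)
  have hRi := tendsto_integral_of_tendsto_whp (P := P)
    (X := fun m ω => ((adaptiveRej α l (M m) (p m ω) : ℝ))⁻¹)
    (fun m => ((hM m).measurable_rej_cast.comp (hpm m)).inv) (B := 1)
    (fun m ω => abs_le_one_of_mem_Icc ⟨by positivity, natCast_inv_le_one _⟩)
    (tendsto_inv_atTop_zero.comp (tendsto_natCast_atTop_atTop.comp hR))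
  have hlim := (hRi.add hW2).sub (hWi.pow 2)
  rw [zero_add, sub_self] at hlim
  intro η hη
  have hlim2 := ENNReal.tendsto_ofReal (hlim.div_const (η ^ 2))
  rw [zero_div, ENNReal.ofReal_zero] at hlim2
  refine tendsto_of_tendsto_of_tendsto_of_le_of_le tendsto_const_nhds hlim2
    (fun _ => zero_le) fun m => ?_
  have hL : MemLp (fun ω => FDP (critAdaptive α l (M m (p m ω))) (p m ω) (I₀ m)) 2 (P m) :=
    MemLp.of_bound (((hM m).measurable_FDP (I₀ m)).comp (hpm m)).aestronglyMeasurable 1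
      (ae_of_all _ fun ω => abs_le_one_of_mem_Icc
        ⟨FDP_nonneg _ _ _, (hM m).FDP_le_one _ _⟩)
  have hch := meas_ge_le_variance_div_sq hL hη
  simp only [sub_zero]
  refine hch.trans (ENNReal.ofReal_le_ofReal ?_)
  rw [variance_eq_sub hL, (hM m).integral_FDP (hBI m)]
  refine div_le_div_of_nonneg_right (sub_le_sub_right ?_ _) (sq_nonneg η)
  exact (hM m).integral_FDP_sq_le (hBI m)

/-- The constant estimator of the Benjamini-Hochberg test. -/
noncomputable def trivialEst (m : ℕ) (_ : Fin m → ℝ) : ℝ := max (m : ℝ) 1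

theorem trivialEst_eq {m : ℕ} (hm : 1 ≤ m) (q : Fin m → ℝ) : trivialEst m q = m :=
  max_eq_left (by exact_mod_cast hm)

theorem nullEstimator_trivialEst {α : ℝ} (hα : 0 < α) (hα1 : α ≤ 1) (m : ℕ) :
    NullEstimator α 1 (trivialEst m) where
  alpha_pos := hα
  cap_pos := one_pos
  cap_le := le_rfl
  measurable := measurable_const
  one_le := fun _ => le_max_right _ _
  le_apply := fun q => by
    have h : (countLE Finset.univ q 1 : ℝ) ≤ m := by exact_mod_cast countLE_univ_le q 1
    rw [div_one]
    exact (mul_le_of_le_one_left (Nat.cast_nonneg _) hα1).trans (h.trans (le_max_left _ _))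
  apply_update := fun _ _ _ => rfl

theorem critBH_eq {α : ℝ} (hα : 0 < α) (hα1 : α ≤ 1) {m : ℕ} (q : Fin m → ℝ) {i : ℕ}
    (hi : i ≤ m) : critBH α m i = critAdaptive α 1 (trivialEst m q) i := by
  rcases Nat.eq_zero_or_pos m with rfl | hm
  · obtain rfl : i = 0 := by omega
    simp [critBH, critAdaptive]
  · rw [critAdaptive, trivialEst_eq hm, critBH, min_eq_left]
    have : (i : ℝ) / m ≤ 1 := div_le_one_of_le₀ (by exact_mod_cast hi) (Nat.cast_nonneg _)
    exact mul_le_one₀ this hα.le hα1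

theorem fdpBH_eq {α : ℝ} (hα : 0 < α) (hα1 : α ≤ 1) {m : ℕ} (I : Finset (Fin m))
    (q : Fin m → ℝ) : fdpBH α I q = FDP (critAdaptive α 1 (trivialEst m q)) q I :=
  FDP_congr q I fun _ hi => critBH_eq hα hα1 q hi

/-- With cap one every true null is counted, so `nullFraction` is deterministic. -/
theorem integral_fdpBH {α : ℝ} (hα : 0 < α) (hα1 : α ≤ 1) {m : ℕ} (hm : 1 ≤ m)
    (hBI : BasicIndependence (P m) (p m) (I₀ m)) :
    ∫ ω, fdpBH α (I₀ m) (p m ω) ∂(P m) = (I₀ m).card / m * α := by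
  simp only [fdpBH_eq hα hα1]
  rw [(nullEstimator_trivialEst hα hα1 m).integral_FDP hBI]
  have : ∀ ω, nullFraction α 1 (trivialEst m) (I₀ m) (p m ω) = (I₀ m).card / m * α := by
    intro ω
    rw [nullFraction, countLE_eq_card_of_le fun i => (hBI.mem_Icc ω i).2, trivialEst_eq hm]
    ring
  simp [this]

theorem tendsto_integral_fdpBH (hBI : ∀ m, BasicIndependence (P m) (p m) (I₀ m)) {α κ₀ : ℝ}
    (hα : 0 < α) (hα1 : α ≤ 1)
    (hA1 : Tendsto (fun m : ℕ => ((I₀ m).card : ℝ) / (m : ℝ)) atTop (𝓝 κ₀)) :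
    Tendsto (fun m => ∫ ω, fdpBH α (I₀ m) (p m ω) ∂(P m)) atTop (𝓝 (κ₀ * α)) := by
  refine (hA1.mul_const α).congr' ?_
  filter_upwards [eventually_ge_atTop 1] with m hm
  exact (integral_fdpBH hα hα1 hm (hBI m)).symm

/-- Having at most `K` rejections is an increasing event in the p-values. If in addition all true
nulls exceed `K α / m`, which bounds the rejection threshold, none of them is rejected. -/
theorem pow_mul_measureReal_rej_le {α : ℝ} (hα : 0 < α) (hα1 : α ≤ 1) {m : ℕ} (K : ℕ)
    (hK : K < m) (hBI : BasicIndependence (P m) (p m) (I₀ m)) :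
    (1 + -(K * α) / m) ^ m * (P m).real {ω | adaptiveRej α 1 (trivialEst m) (p m ω) ≤ K} ≤
      (P m).real {ω | fdpBH α (I₀ m) (p m ω) = 0} := by
  have hm : 1 ≤ m := by omega
  have hm' : (0 : ℝ) < m := by exact_mod_cast hm
  have hM := nullEstimator_trivialEst hα hα1 m
  have hs : (K : ℝ) / m * α ∈ Set.Icc (0 : ℝ) 1 := by
    refine ⟨by positivity, mul_le_one₀ ?_ hα.le hα1⟩
    exact div_le_one_of_le₀ (by exact_mod_cast hK.le) hm'.le
  have key := hBI.pow_mul_measureReal_le_inter hs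
    (S := {q | adaptiveRej α 1 (trivialEst m) q ≤ K})
    (hM.measurable_rej (measurableSet_Iic (a := K)))
    (fun q q' hq hqS => le_trans (numRej_mono (fun _ _ => le_rfl) hq) hqS) subset_rfl
  refine le_trans ?_ (key.trans (measureReal_mono ?_))
  · rw [show 1 + -(K * α) / m = 1 - (K : ℝ) / m * α by ring]
    refine mul_le_mul_of_nonneg_right ?_ measureReal_nonneg
    exact pow_le_pow_of_le_one (sub_nonneg.2 hs.2) (by linarith [hs.1])
      ((Finset.card_le_univ _).trans (by simp))
  · rintro ω ⟨hω, hnull⟩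
    simp only [Set.mem_ofPred_eq] at hω ⊢
    rw [fdpBH_eq hα hα1, FDP_critAdaptive]
    refine Finset.sum_eq_zero fun i hi => ?_
    rw [if_neg, zero_mul]
    rw [not_le]
    refine lt_of_le_of_lt ?_ (hnull i hi)
    rw [hM.thr_eq, trivialEst_eq hm]
    gcongr

/-- For a consistent Benjamini-Hochberg test the number of rejections tends to infinity. -/
theorem tendsto_rej_of_consistent (hBI : ∀ m, BasicIndependence (P m) (p m) (I₀ m)) {α κ₀ : ℝ}
    (hα : 0 < α) (hα1 : α ≤ 1) (hκ₀ : 0 < κ₀)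
    (hA1 : Tendsto (fun m : ℕ => ((I₀ m).card : ℝ) / (m : ℝ)) atTop (𝓝 κ₀))
    (hc : Consistent P fun m ω => fdpBH α (I₀ m) (p m ω)) :
    Tendsto (fun x : Σ m, Ω m => adaptiveRej α 1 (trivialEst x.1) (p x.1 x.2)) (whp P)
      atTop := by
  rw [tendsto_atTop]
  intro K
  rw [eventually_whp_iff]
  have hκα : 0 < κ₀ * α := mul_pos hκ₀ hα
  -- Where the proportion vanishes it is eventually at distance at least `κ₀ α / 2` from its mean,
  -- which consistency makes improbable.
  have h0 : Tendsto (fun m => (P m).real {ω | fdpBH α (I₀ m) (p m ω) = 0}) atTop (𝓝 0) := by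
    have h1 := (ENNReal.tendsto_toReal ENNReal.zero_ne_top).comp
      (hc (κ₀ * α / 2) (by positivity))
    rw [ENNReal.toReal_zero] at h1
    refine tendsto_of_tendsto_of_tendsto_of_le_of_le' tendsto_const_nhds h1
      (Eventually.of_forall fun _ => measureReal_nonneg) ?_
    filter_upwards [(tendsto_integral_fdpBH hBI hα hα1 hA1).eventually_const_lt
      (half_lt_self hκα)] with m hm
    refine measureReal_mono fun ω hω => ?_
    simp only [Set.mem_ofPred_eq] at hω ⊢
    rw [hω, sub_zero, zero_sub, abs_neg]
    exact hm.le.trans (le_abs_self _)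
  -- The factor from the correlation inequality tends to exp(-Kα) > 0, so dividing by it keeps the
  -- limit zero.
  have hexp := Real.tendsto_one_add_div_pow_exp (-(K * α))
  have h1 : Tendsto (fun m : ℕ => (P m).real {ω | fdpBH α (I₀ m) (p m ω) = 0} /
      (1 + -(K * α) / m) ^ m) atTop (𝓝 0) := by
    have := h0.div hexp (Real.exp_pos _).ne'
    rwa [zero_div] at this
  have h2 : Tendsto (fun m : ℕ => (P m).real
      {ω | adaptiveRej α 1 (trivialEst m) (p m ω) ≤ K}) atTop (𝓝 0) := by
    refine tendsto_of_tendsto_of_tendsto_of_le_of_le' tendsto_const_nhds h1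
      (Eventually.of_forall fun _ => measureReal_nonneg) ?_
    filter_upwards [eventually_gt_atTop K, hexp.eventually_const_lt (Real.exp_pos _)]
      with m hm hpos
    rw [le_div_iff₀' hpos]
    exact pow_mul_measureReal_rej_le hα hα1 K hm (hBI m)
  have h3 := ENNReal.tendsto_ofReal h2
  rw [ENNReal.ofReal_zero] at h3
  refine tendsto_of_tendsto_of_tendsto_of_le_of_le tendsto_const_nhds h3
    (fun _ => zero_le) fun m => ?_
  simp only
  rw [ofReal_measureReal]
  exact measure_mono fun ω hω => (not_le.1 hω).le

/-- The scale `x` is left free: `m * t m` serves shrinking thresholds, the number of false nulls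
serves the case κ₀ = 1 of (c). -/
theorem tendsto_countLE_sub_div (hBI : ∀ m, BasicIndependence (P m) (p m) (I₀ m))
    {t x : ℕ → ℝ} (ht : ∀ m, t m ∈ Set.Icc (0 : ℝ) 1) (hx : ∀ᶠ m in atTop, 0 < x m)
    (htx : Tendsto (fun m : ℕ => (m : ℝ) * t m / x m ^ 2) atTop (𝓝 0)) :
    Tendsto (fun y : Σ m, Ω m =>
      ((countLE (I₀ y.1) (p y.1 y.2) (t y.1) : ℝ) - (I₀ y.1).card * t y.1) / x y.1)
      (whp P) (𝓝 0) := by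
  rw [← convInProb_iff_tendsto_whp (X := fun m ω =>
    ((countLE (I₀ m) (p m ω) (t m) : ℝ) - (I₀ m).card * t m) / x m)]
  intro η hη
  have hlim := ENNReal.tendsto_ofReal (htx.div_const (η ^ 2))
  rw [zero_div, ENNReal.ofReal_zero] at hlim
  refine tendsto_of_tendsto_of_tendsto_of_le_of_le' tendsto_const_nhds hlim
    (Eventually.of_forall fun _ => zero_le) ?_
  filter_upwards [hx] with m hxm
  have hch := (hBI m).measure_le_abs_countLE_sub (ht m) (mul_pos hη hxm)
  refine le_trans (measure_mono fun ω hω => ?_) (hch.trans (ENNReal.ofReal_le_ofReal ?_))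
  · simp only [Set.mem_ofPred_eq, sub_zero] at hω ⊢
    rwa [abs_div, abs_of_pos hxm, le_div_iff₀ hxm] at hω
  · have hcard : ((I₀ m).card : ℝ) ≤ m := by
      exact_mod_cast (Finset.card_le_univ _).trans (by simp)
    have := (ht m).1
    rw [div_div, mul_pow, mul_comm (η ^ 2)]
    gcongr

theorem tendsto_countLE_div_mul (hBI : ∀ m, BasicIndependence (P m) (p m) (I₀ m)) {κ₀ : ℝ}
    (hA1 : Tendsto (fun m : ℕ => ((I₀ m).card : ℝ) / (m : ℝ)) atTop (𝓝 κ₀))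
    {t : ℕ → ℝ} (ht : ∀ m, t m ∈ Set.Ioc (0 : ℝ) 1)
    (hmt : Tendsto (fun m : ℕ => (m : ℝ) * t m) atTop atTop) :
    Tendsto (fun y : Σ m, Ω m => (countLE (I₀ y.1) (p y.1 y.2) (t y.1) : ℝ) / (y.1 * t y.1))
      (whp P) (𝓝 κ₀) := by
  have h1 := tendsto_countLE_sub_div hBI (t := t) (x := fun m => m * t m)
    (fun m => ⟨(ht m).1.le, (ht m).2⟩) (hmt.eventually_gt_atTop 0) (by
      refine (tendsto_inv_atTop_zero.comp hmt).congr' ?_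
      filter_upwards [hmt.eventually_gt_atTop 0] with m hm
      simp only [Function.comp_apply]
      field_simp)
  have h2 := h1.add (hA1.comp tendsto_fst_whp)
  rw [zero_add] at h2
  refine h2.congr' ?_
  filter_upwards [tendsto_fst_whp.eventually (eventually_ge_atTop 1)] with y hy
  have hy' : (0 : ℝ) < y.1 := by exact_mod_cast hy
  have ht' := (ht y.1).1
  simp only [Function.comp_apply]
  field_simp
  ring

theorem tendsto_countLE_div (hBI : ∀ m, BasicIndependence (P m) (p m) (I₀ m)) {κ₀ : ℝ}
    (hA1 : Tendsto (fun m : ℕ => ((I₀ m).card : ℝ) / (m : ℝ)) atTop (𝓝 κ₀))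
    {t : ℝ} (ht : t ∈ Set.Ioc (0 : ℝ) 1) :
    Tendsto (fun y : Σ m, Ω m => (countLE (I₀ y.1) (p y.1 y.2) t : ℝ) / y.1)
      (whp P) (𝓝 (κ₀ * t)) := by
  have h1 := (tendsto_countLE_div_mul hBI hA1 (t := fun _ => t) (fun _ => ht)
    (tendsto_natCast_atTop_atTop.atTop_mul_const ht.1)).mul_const t
  refine h1.congr fun y => ?_
  have := ht.1.ne'
  field_simp

theorem tendsto_compl_card_div {κ₀ : ℝ}
    (hA1 : Tendsto (fun m : ℕ => ((I₀ m).card : ℝ) / (m : ℝ)) atTop (𝓝 κ₀)) :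
    Tendsto (fun m : ℕ => (((I₀ m)ᶜ.card : ℕ) : ℝ) / (m : ℝ)) atTop (𝓝 (1 - κ₀)) := by
  refine (hA1.const_sub 1).congr' ?_
  filter_upwards [eventually_ge_atTop 1] with m hm
  have hm' : (m : ℝ) ≠ 0 := by positivity
  have hc : (I₀ m).card ≤ m := (Finset.card_le_univ _).trans (by simp)
  rw [Finset.card_compl, Fintype.card_fin, Nat.cast_sub hc]
  field_simp

end Asymptotics

/-! ### Deterministic bounds for the combined estimator. -/

/-- Without false nulls the second summand is zero by the convention for `empCDF`. -/
theorem empCDF_univ_eq {m : ℕ} (I : Finset (Fin m)) (q : Fin m → ℝ) (t : ℝ) :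
    empCDF Finset.univ q t =
      (countLE I q t : ℝ) / m + ((Iᶜ.card : ℕ) : ℝ) / m * empCDF Iᶜ q t := by
  rw [empCDF_eq, empCDF_eq, ← countLE_add_compl I, Finset.card_univ, Fintype.card_fin]
  push_cast
  rcases Nat.eq_zero_or_pos Iᶜ.card with h | h
  · have h1 : countLE Iᶜ q t = 0 := Nat.le_zero.1 (h ▸ countLE_le_card _ _ _)
    simp [h, h1]
  · have : ((Iᶜ.card : ℕ) : ℝ) ≠ 0 := by positivity
    field_simp

theorem empCDF_mem_Icc {m : ℕ} (I : Finset (Fin m)) (q : Fin m → ℝ) (t : ℝ) :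
    empCDF I q t ∈ Set.Icc (0 : ℝ) 1 :=
  ⟨by unfold empCDF; positivity, div_le_one_of_le₀
    (by exact_mod_cast countLE_le_card I q t) (Nat.cast_nonneg _)⟩

theorem empCDF_univ_eq_one {m : ℕ} (hm : 1 ≤ m) {q : Fin m → ℝ} {t : ℝ} (h : ∀ i, q i ≤ t) :
    empCDF Finset.univ q t = 1 := by
  rw [empCDF_eq, countLE_eq_card_of_le h, div_self]
  simp only [Finset.card_univ, Fintype.card_fin]
  positivity

/-- `0 < lam 0 < lam 1 < … < lam k = 1` with `lam 0 < 1`. -/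
structure IsGrid (k : ℕ) (lam : ℕ → ℝ) : Prop where
  zero_pos : 0 < lam 0
  zero_lt : lam 0 < 1
  lt_succ : ∀ i < k, lam i < lam (i + 1)
  last : lam k = 1

theorem sum_Icc_one_eq_sum_range (k : ℕ) (f : ℕ → ℝ) :
    ∑ i ∈ Finset.Icc 1 k, f i = ∑ i ∈ Finset.range k, f (i + 1) := by
  induction k with
  | zero => simp
  | succ k ih => rw [Finset.sum_Icc_succ_top (by omega), ih, Finset.sum_range_succ]

theorem sum_range_mul_sub_eq (k : ℕ) (g F : ℕ → ℝ) :
    ∑ i ∈ Finset.range k, g (i + 1) * (F (i + 1) - F i) =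
      g k * F k - g 0 * F 0 - ∑ i ∈ Finset.range k, (g (i + 1) - g i) * F i := by
  induction k with
  | zero => simp
  | succ k ih => rw [Finset.sum_range_succ, ih, Finset.sum_range_succ]; ring

/-- Bound for the sum of the normalized weights. -/
noncomputable def gridBound (k : ℕ) (lam : ℕ → ℝ) : ℝ :=
  ∑ i ∈ Finset.range k, 1 / (lam (i + 1) - lam i)

namespace IsGrid

variable {k : ℕ} {lam : ℕ → ℝ} (hg : IsGrid k lam)
include hg

theorem le_of_le {i j : ℕ} (hij : i ≤ j) (hj : j ≤ k) : lam i ≤ lam j := by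
  induction j, hij using Nat.le_induction with
  | base => exact le_rfl
  | succ n _ ih => exact (ih (by omega)).trans (hg.lt_succ n (by omega)).le

theorem mem_Ioc {i : ℕ} (hi : i ≤ k) : lam i ∈ Set.Ioc (0 : ℝ) 1 :=
  ⟨hg.zero_pos.trans_le (hg.le_of_le (Nat.zero_le i) hi), (hg.le_of_le hi le_rfl).trans hg.last.le⟩

theorem gap_pos {i : ℕ} (hi : i < k) : 0 < lam (i + 1) - lam i :=
  sub_pos.2 (hg.lt_succ i hi)

theorem gap_le_one {i : ℕ} (hi : i < k) : lam (i + 1) - lam i ≤ 1 := by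
  have h1 := (hg.mem_Ioc (i := i) (by omega)).1
  have h2 := (hg.mem_Ioc (i := i + 1) (by omega)).2
  linarith

theorem k_pos : 0 < k := by
  rcases Nat.eq_zero_or_pos k with rfl | h
  · exact absurd hg.last hg.zero_lt.ne
  · exact h

theorem gridBound_nonneg : 0 ≤ gridBound k lam :=
  Finset.sum_nonneg fun _ hi =>
    one_div_nonneg.2 (hg.gap_pos (Finset.mem_range.1 hi)).le

end IsGrid

theorem normWeight_succ (lam β : ℕ → ℝ) (i : ℕ) :
    normWeight lam β (i + 1) = β (i + 1) / (lam (i + 1) - lam i) := by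
  simp [normWeight]

section Deterministic

variable {k : ℕ} {lam β : ℕ → ℝ} {m : ℕ} {q : Fin m → ℝ}

theorem weight_le_one (hβ : ∀ i ∈ Finset.Icc 1 k, 0 ≤ β i)
    (hsum : ∑ i ∈ Finset.Icc 1 k, β i = 1) {i : ℕ} (hi : i ∈ Finset.Icc 1 k) : β i ≤ 1 :=
  hsum ▸ Finset.single_le_sum hβ hi

theorem storeyComb_div (hm : 1 ≤ m) :
    storeyComb k lam β q / m = ∑ i ∈ Finset.range k, β (i + 1) *
      ((empCDF Finset.univ q (lam (i + 1)) - empCDF Finset.univ q (lam i) + 1 / (m : ℝ)) /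
        (lam (i + 1) - lam i)) := by
  have hm' : (m : ℝ) ≠ 0 := by positivity
  rw [storeyComb, sum_Icc_one_eq_sum_range, Finset.sum_div]
  refine Finset.sum_congr rfl fun i _ => ?_
  simp only [storeyInterval, Nat.add_sub_cancel]
  rw [mul_left_comm, mul_div_cancel_left₀ _ hm']

theorem storeyHat_div {α : ℝ} (hm : 1 ≤ m) :
    storeyHat α k lam β q / m =
      max (storeyComb k lam β q / m) (α / lam 0 * empCDF Finset.univ q (lam 0)) := by
  have hm' : (0 : ℝ) < m := by exact_mod_cast hm
  rw [storeyHat, ← max_div_div_right hm'.le]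
  congr 1
  field_simp

/-- The summand 1/m in each interval estimator contributes at least one, as the gaps are at most
one; the weights average these values. -/
theorem one_le_storeyHat (hg : IsGrid k lam) (α : ℝ) (hm : 1 ≤ m)
    (hβ : ∀ i ∈ Finset.Icc 1 k, 0 ≤ β i) (hsum : ∑ i ∈ Finset.Icc 1 k, β i = 1) :
    1 ≤ storeyHat α k lam β q := by
  refine le_trans ?_ (le_max_left _ _)
  have hm' : (0 : ℝ) < m := by exact_mod_cast hm
  rw [storeyComb, ← hsum]
  refine Finset.sum_le_sum fun i hi => le_mul_of_one_le_right (hβ i hi) ?_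
  obtain ⟨n, rfl⟩ : ∃ n, i = n + 1 := ⟨i - 1, by have := Finset.mem_Icc.1 hi; omega⟩
  have hn : n < k := by have := Finset.mem_Icc.1 hi; omega
  simp only [storeyInterval, Nat.add_sub_cancel]
  have h1 := hg.gap_pos hn
  have h2 := hg.gap_le_one hn
  have h3 : empCDF Finset.univ q (lam n) ≤ empCDF Finset.univ q (lam (n + 1)) := by
    rw [empCDF_eq, empCDF_eq]
    gcongr
    exact countLE_mono _ (fun _ => le_rfl) (hg.lt_succ n hn).le
  rw [← mul_div_assoc, le_div_iff₀ h1, one_mul, mul_add, mul_one_div_cancel hm'.ne']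
  nlinarith

/-- Summation by parts for the combined estimator. -/
theorem storeyComb_div_eq (hg : IsGrid k lam) (hm : 1 ≤ m) (hq : ∀ i, q i ≤ 1)
    (hsum : ∑ i ∈ Finset.Icc 1 k, β i = 1) :
    storeyComb k lam β q / m = 1 + (∑ i ∈ Finset.range k, normWeight lam β (i + 1)) / m -
      ∑ i ∈ Finset.range k, (normWeight lam β (i + 1) - normWeight lam β i) *
        (empCDF Finset.univ q (lam i) - lam i) := by
  have h1 := sum_range_mul_sub_eq k (normWeight lam β) fun i => empCDF Finset.univ q (lam i)
  have h2 := sum_range_mul_sub_eq k (normWeight lam β) lam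
  have h3 : ∑ i ∈ Finset.range k, normWeight lam β (i + 1) * (lam (i + 1) - lam i) = 1 := by
    rw [← hsum, sum_Icc_one_eq_sum_range]
    refine Finset.sum_congr rfl fun i hi => ?_
    rw [normWeight_succ, div_mul_cancel₀ _ (hg.gap_pos (Finset.mem_range.1 hi)).ne']
  have h4 : storeyComb k lam β q / m = ∑ i ∈ Finset.range k, normWeight lam β (i + 1) *
      (empCDF Finset.univ q (lam (i + 1)) - empCDF Finset.univ q (lam i)) +
      (∑ i ∈ Finset.range k, normWeight lam β (i + 1)) / m := by
    rw [storeyComb_div hm, Finset.sum_div, ← Finset.sum_add_distrib]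
    refine Finset.sum_congr rfl fun i _ => ?_
    rw [normWeight_succ]
    ring
  have h5 : empCDF Finset.univ q (lam k) = 1 :=
    empCDF_univ_eq_one hm fun i => (hq i).trans hg.last.ge
  have h0 : normWeight lam β 0 = 0 := by simp [normWeight]
  simp only [mul_sub, Finset.sum_sub_distrib]
  simp only [mul_sub, Finset.sum_sub_distrib] at h1 h2 h3 h4
  rw [h5, h0] at h1
  rw [hg.last, h0] at h2
  linarith

theorem normWeight_nonneg (hg : IsGrid k lam) (hβ : ∀ i ∈ Finset.Icc 1 k, 0 ≤ β i) {i : ℕ}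
    (hi : i < k) : 0 ≤ normWeight lam β (i + 1) := by
  rw [normWeight_succ]
  exact div_nonneg (hβ _ (Finset.mem_Icc.2 ⟨by omega, by omega⟩)) (hg.gap_pos hi).le

theorem sum_normWeight_le (hg : IsGrid k lam) (hβ : ∀ i ∈ Finset.Icc 1 k, 0 ≤ β i)
    (hsum : ∑ i ∈ Finset.Icc 1 k, β i = 1) :
    ∑ i ∈ Finset.range k, normWeight lam β (i + 1) ≤ gridBound k lam := by
  refine Finset.sum_le_sum fun i hi => ?_
  rw [Finset.mem_range] at hi
  rw [normWeight_succ]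
  have := hg.gap_pos hi
  have := weight_le_one hβ hsum (i := i + 1) (Finset.mem_Icc.2 ⟨by omega, by omega⟩)
  gcongr

theorem normWeight_le (hg : IsGrid k lam) (hβ : ∀ i ∈ Finset.Icc 1 k, 0 ≤ β i)
    (hsum : ∑ i ∈ Finset.Icc 1 k, β i = 1) {i : ℕ} (hi : i ≤ k) :
    normWeight lam β i ≤ gridBound k lam := by
  rcases Nat.eq_zero_or_pos i with rfl | h0
  · simpa [normWeight] using hg.gridBound_nonneg
  · obtain ⟨n, rfl⟩ : ∃ n, i = n + 1 := ⟨i - 1, by omega⟩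
    refine le_trans ?_ (sum_normWeight_le hg hβ hsum)
    exact Finset.single_le_sum (f := fun i => normWeight lam β (i + 1))
      (fun i hi => normWeight_nonneg hg hβ (Finset.mem_range.1 hi))
      (Finset.mem_range.2 (by omega))

/-- In the summation by parts all increments are nonnegative, so the lower bounds on F may be
inserted. Only the `j`-th gain is kept; the errors `η` telescope to `η` times the last normalized
weight. The factor `x` is 1 for (b) and m₁/m for (c). -/
theorem storeyComb_div_le (hg : IsGrid k lam) (hm : 1 ≤ m) (hq : ∀ i, q i ≤ 1)
    (hβ : ∀ i ∈ Finset.Icc 1 k, 0 ≤ β i) (hsum : ∑ i ∈ Finset.Icc 1 k, β i = 1)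
    (hmono : MonotoneWeights k lam β) {ε : ℕ → ℝ} (hε : ∀ i < k, 0 ≤ ε i) {x η : ℝ} (hx : 0 ≤ x)
    (hη : 0 ≤ η) (hF : ∀ i < k, lam i + x * (ε i - η) ≤ empCDF Finset.univ q (lam i)) {j : ℕ}
    (hj : j ∈ Finset.Icc 1 k) :
    storeyComb k lam β q / m ≤ 1 + gridBound k lam / m -
      x * ((normWeight lam β j - normWeight lam β (j - 1)) * ε (j - 1) -
        η * gridBound k lam) := by
  have hm' : (0 : ℝ) < m := by exact_mod_cast hm
  have hΔ : ∀ i < k, 0 ≤ normWeight lam β (i + 1) - normWeight lam β i := by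
    intro i hi
    rcases Nat.eq_zero_or_pos i with rfl | h0
    · have := normWeight_nonneg hg hβ hi
      simpa [normWeight] using this
    · exact sub_nonneg.2 (hmono i h0 hi)
  obtain ⟨n, rfl⟩ : ∃ n, j = n + 1 := ⟨j - 1, by have := Finset.mem_Icc.1 hj; omega⟩
  have hn : n < k := by have := Finset.mem_Icc.1 hj; omega
  have h1 : ∑ i ∈ Finset.range k, (normWeight lam β (i + 1) - normWeight lam β i) *
      (x * (ε i - η)) ≤ ∑ i ∈ Finset.range k, (normWeight lam β (i + 1) - normWeight lam β i) *
        (empCDF Finset.univ q (lam i) - lam i) := by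
    refine Finset.sum_le_sum fun i hi => ?_
    have hi' := Finset.mem_range.1 hi
    exact mul_le_mul_of_nonneg_left (by linarith [hF i hi']) (hΔ i hi')
  have h2 : ∑ i ∈ Finset.range k, (normWeight lam β (i + 1) - normWeight lam β i) *
      (x * (ε i - η)) = x * (∑ i ∈ Finset.range k,
        (normWeight lam β (i + 1) - normWeight lam β i) * ε i - η * normWeight lam β k) := by
    have h0 : normWeight lam β 0 = 0 := by simp [normWeight]
    have h3 := Finset.sum_range_sub (normWeight lam β) k
    rw [h0, sub_zero] at h3
    rw [← h3, Finset.mul_sum, ← Finset.sum_sub_distrib, Finset.mul_sum]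
    refine Finset.sum_congr rfl fun i _ => ?_
    ring
  have h4 : (normWeight lam β (n + 1) - normWeight lam β n) * ε n ≤ ∑ i ∈ Finset.range k,
        (normWeight lam β (i + 1) - normWeight lam β i) * ε i :=
    Finset.single_le_sum (f := fun i => (normWeight lam β (i + 1) - normWeight lam β i) * ε i)
      (fun i hi => mul_nonneg (hΔ i (Finset.mem_range.1 hi)) (hε i (Finset.mem_range.1 hi)))
      (Finset.mem_range.2 hn)
  have h5 := mul_le_mul_of_nonneg_left (normWeight_le hg hβ hsum le_rfl) hη
  have h6 := sum_normWeight_le hg hβ hsum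
  have h7 : (∑ i ∈ Finset.range k, normWeight lam β (i + 1)) / m ≤ gridBound k lam / m := by
    gcongr
  rw [storeyComb_div_eq hg hm hq hsum]
  simp only [Nat.add_sub_cancel]
  have h8 := mul_le_mul_of_nonneg_left (sub_le_sub h4 h5) hx
  linarith

end Deterministic

/-! ### The adaptive estimator as a `NullEstimator`, and comparison of rejection numbers. -/

/-- The estimator of the adaptive test, truncated from below at one. -/
noncomputable def storeyEst (α : ℝ) (k : ℕ) (lam : ℕ → ℝ) (b : ∀ i, (Set.Ici (lam i) → ℝ) → ℝ)
    {m : ℕ} (q : Fin m → ℝ) : ℝ :=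
  max (storeyHat α k lam (weights b q) q) 1

section StoreyEst

variable {α : ℝ} {k : ℕ} {lam : ℕ → ℝ} {b : ∀ i, (Set.Ici (lam i) → ℝ) → ℝ} {m : ℕ}

theorem measurable_weights {i : ℕ} (hb : Measurable (b i)) :
    Measurable fun q : Fin m → ℝ => weights b q i :=
  hb.comp (measurable_pi_lambda _ fun _ => measurable_empCDF _ _)

theorem measurable_storeyHat (hb : ∀ i ∈ Finset.Icc 1 k, Measurable (b i)) :
    Measurable fun q : Fin m → ℝ => storeyHat α k lam (weights b q) q := by
  refine Measurable.max (Finset.measurable_sum _ fun i hi => ?_)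
    (((measurable_empCDF _ _).const_mul _).const_mul _)
  refine (measurable_weights (hb i hi)).mul (Measurable.const_mul ?_ _)
  exact (((measurable_empCDF _ _).sub (measurable_empCDF _ _)).add_const _).div_const _

theorem empCDF_update {q : Fin m → ℝ} {i : Fin m} {t : ℝ} (ht : 0 ≤ t) (hi : q i ≤ t) :
    empCDF Finset.univ (Function.update q i 0) t = empCDF Finset.univ q t := by
  rw [empCDF_eq, empCDF_eq, countLE_update _ ht hi]

/-- The estimator and its weights see the empirical distribution function only from `lam 0` on,
where moving a p-value from below `lam 0` to zero has no effect. -/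
theorem storeyHat_update (hg : IsGrid k lam) {q : Fin m → ℝ} {i : Fin m} (hi : q i ≤ lam 0) :
    storeyHat α k lam (weights b (Function.update q i 0)) (Function.update q i 0) =
      storeyHat α k lam (weights b q) q := by
  have hF : ∀ t, lam 0 ≤ t →
      empCDF Finset.univ (Function.update q i 0) t = empCDF Finset.univ q t :=
    fun t ht => empCDF_update (hg.zero_pos.le.trans ht) (hi.trans ht)
  unfold storeyHat storeyComb
  rw [hF _ le_rfl]
  congr 1
  refine Finset.sum_congr rfl fun n hn => ?_
  rw [Finset.mem_Icc] at hn
  have h1 := hg.le_of_le (Nat.zero_le n) hn.2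
  have h2 := hg.le_of_le (Nat.zero_le (n - 1)) (by omega)
  congr 1
  · unfold weights
    congr 1
    funext t
    exact hF _ (h1.trans t.2)
  · unfold storeyInterval
    rw [hF _ h1, hF _ h2]

theorem nullEstimator_storeyEst (hg : IsGrid k lam) (hα : 0 < α)
    (hb : ∀ i ∈ Finset.Icc 1 k, Measurable (b i)) :
    NullEstimator α (lam 0) (storeyEst α k lam b (m := m)) where
  alpha_pos := hα
  cap_pos := hg.zero_pos
  cap_le := hg.zero_lt.le
  measurable := (measurable_storeyHat hb).max measurable_const
  one_le := fun _ => le_max_right _ _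
  le_apply := fun q => by
    refine le_trans (le_of_eq ?_) ((le_max_right _ _).trans (le_max_left _ _))
    rw [empCDF_eq, Finset.card_univ, Fintype.card_fin]
    rcases Nat.eq_zero_or_pos m with rfl | hm
    · have : countLE Finset.univ q (lam 0) = 0 := Nat.le_zero.1 (countLE_univ_le _ _)
      rw [this]
      simp
    · have : (m : ℝ) ≠ 0 := by positivity
      field_simp
  apply_update := fun q i hi => by
    unfold storeyEst
    rw [storeyHat_update hg hi]

theorem storeyEst_eq (hg : IsGrid k lam) (hm : 1 ≤ m) {q : Fin m → ℝ}
    (hβ : ∀ i ∈ Finset.Icc 1 k, 0 ≤ weights b q i)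
    (hsum : ∑ i ∈ Finset.Icc 1 k, weights b q i = 1) :
    storeyEst α k lam b q = storeyHat α k lam (weights b q) q :=
  max_eq_left (one_le_storeyHat hg α hm hβ hsum)

theorem fdpStorey_eq (hg : IsGrid k lam) (I : Finset (Fin m)) {q : Fin m → ℝ}
    (hβ : ∀ i ∈ Finset.Icc 1 k, 0 ≤ weights b q i)
    (hsum : ∑ i ∈ Finset.Icc 1 k, weights b q i = 1) :
    fdpStorey α k lam b I q = FDP (critAdaptive α (lam 0) (storeyEst α k lam b q)) q I := by
  refine FDP_congr q I fun i hi => ?_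
  rcases Nat.eq_zero_or_pos m with rfl | hm
  · obtain rfl : i = 0 := by omega
    simp [critAdaptive]
  · rw [storeyEst_eq hg hm hβ hsum]

end StoreyEst

/-- The assumption puts `t` below the critical value whose index is the count at `t`, so this index
is admissible. -/
theorem countLE_le_adaptiveRej {m : ℕ} {α l t : ℝ} {M : (Fin m → ℝ) → ℝ} {q : Fin m → ℝ}
    (hM : 0 < M q) (htl : t ≤ l) (h : t * M q ≤ countLE Finset.univ q t * α) :
    countLE Finset.univ q t ≤ adaptiveRej α l M q := by
  refine le_numRej (countLE_univ_le _ _) (countLE_mono _ (fun _ => le_rfl) (le_min ?_ htl))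
  rwa [div_mul_eq_mul_div, le_div_iff₀ hM]

/-- A smaller estimate raises the critical values, and the cap does no harm because BH critical
values never exceed `α ≤ l`. -/
theorem adaptiveRej_trivialEst_le {m : ℕ} {α l : ℝ} (hα : 0 ≤ α) (hαl : α ≤ l)
    {M : (Fin m → ℝ) → ℝ} {q : Fin m → ℝ} (hM : 0 < M q) (h : M q ≤ m) :
    adaptiveRej α 1 (trivialEst m) q ≤ adaptiveRej α l M q := by
  refine numRej_mono (fun i hi => ?_) fun _ => le_rfl
  have hm : (0 : ℝ) < m := hM.trans_le h
  refine (min_le_left _ _).trans (le_min ?_ ?_)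
  · rw [trivialEst_eq (by exact_mod_cast hm)]
    gcongr
  · rw [trivialEst_eq (by exact_mod_cast hm)]
    have : (i : ℝ) / m ≤ 1 := div_le_one_of_le₀ (by exact_mod_cast hi) hm.le
    exact (mul_le_of_le_one_left hα this).trans hαl

/-! ### Limits of the false discovery rate. -/

/-- Standing assumptions on the adaptive test. -/
structure AdaptiveSetting {Ω : ℕ → Type*} [∀ m, MeasurableSpace (Ω m)]
    (P : ∀ m, Measure (Ω m)) (p : ∀ m, Ω m → Fin m → ℝ) (I₀ : ∀ m, Finset (Fin m))
    (α : ℝ) (k : ℕ) (lam : ℕ → ℝ) (b : ∀ _ : ℕ, ∀ i, (Set.Ici (lam i) → ℝ) → ℝ)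
    (κ₀ : ℝ) : Prop where
  basic : ∀ m, BasicIndependence (P m) (p m) (I₀ m)
  alpha_pos : 0 < α
  alpha_le : α ≤ lam 0
  grid : IsGrid k lam
  weights_meas : ∀ m, ∀ i ∈ Finset.Icc 1 k, Measurable (b m i)
  weights_nonneg : ∀ m, ∀ ω : Ω m, ∀ i ∈ Finset.Icc 1 k, 0 ≤ weights (b m) (p m ω) i
  weights_sum : ∀ m, ∀ ω : Ω m, ∑ i ∈ Finset.Icc 1 k, weights (b m) (p m ω) i = 1
  kappa_pos : 0 < κ₀
  kappa_le : κ₀ ≤ 1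
  tendsto_card : Tendsto (fun m : ℕ => ((I₀ m).card : ℝ) / (m : ℝ)) atTop (𝓝 κ₀)
  kappa_lt : α * (1 - κ₀) / (lam 0 * (1 - α)) < κ₀

namespace AdaptiveSetting

variable {Ω : ℕ → Type*} [∀ m, MeasurableSpace (Ω m)] {P : ∀ m, Measure (Ω m)}
  [∀ m, IsProbabilityMeasure (P m)] {p : ∀ m, Ω m → Fin m → ℝ} {I₀ : ∀ m, Finset (Fin m)}
  {α : ℝ} {k : ℕ} {lam : ℕ → ℝ} {b : ∀ _ : ℕ, ∀ i, (Set.Ici (lam i) → ℝ) → ℝ} {κ₀ : ℝ}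

section Basic

omit [∀ m, IsProbabilityMeasure (P m)]
variable (h : AdaptiveSetting P p I₀ α k lam b κ₀)
include h

theorem alpha_lt_one : α < 1 := h.alpha_le.trans_lt h.grid.zero_lt

theorem nullEstimator (m : ℕ) : NullEstimator α (lam 0) (storeyEst α k lam (b m) (m := m)) :=
  nullEstimator_storeyEst h.grid h.alpha_pos (h.weights_meas m)

theorem fdp_eq (m : ℕ) (ω : Ω m) : fdpStorey α k lam (b m) (I₀ m) (p m ω) =
    FDP (critAdaptive α (lam 0) (storeyEst α k lam (b m) (p m ω))) (p m ω) (I₀ m) :=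
  fdpStorey_eq h.grid _ (h.weights_nonneg m ω) (h.weights_sum m ω)

theorem est_eq {m : ℕ} (hm : 1 ≤ m) (ω : Ω m) : storeyEst α k lam (b m) (p m ω) =
    storeyHat α k lam (weights (b m) (p m ω)) (p m ω) :=
  storeyEst_eq h.grid hm (h.weights_nonneg m ω) (h.weights_sum m ω)

/-- The left side is the limit of the lower truncation point over m in the worst case that all false
nulls have p-values at most `lam 0`. -/
theorem cap_lt_one : α / lam 0 * (κ₀ * lam 0 + (1 - κ₀)) < 1 := by
  have h1 := h.kappa_lt
  have hl := h.grid.zero_pos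
  have hα : 0 < 1 - α := sub_pos.2 h.alpha_lt_one
  rw [div_lt_iff₀ (by positivity)] at h1
  rw [div_mul_eq_mul_div, div_lt_one hl]
  have h2 := mul_le_mul_of_nonneg_right h.kappa_le hl.le
  nlinarith

theorem measurable_weights_comp (m : ℕ) {i : ℕ} (hi : i ∈ Finset.Icc 1 k) :
    Measurable fun ω => weights (b m) (p m ω) i :=
  (measurable_weights (h.weights_meas m i hi)).comp (h.basic m).measurable_fun

theorem measurable_empCDF_comp (s : ∀ m, Finset (Fin m)) (m : ℕ) (t : ℝ) :
    Measurable fun ω => empCDF (s m) (p m ω) t :=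
  (measurable_empCDF (s m) t).comp (h.basic m).measurable_fun

end Basic

variable (h : AdaptiveSetting P p I₀ α k lam b κ₀)
include h

theorem integral_fdp (m : ℕ) : ∫ ω, fdpStorey α k lam (b m) (I₀ m) (p m ω) ∂(P m) =
    ∫ ω, nullFraction α (lam 0) (storeyEst α k lam (b m)) (I₀ m) (p m ω) ∂(P m) := by
  simp only [h.fdp_eq]
  exact (h.nullEstimator m).integral_FDP (h.basic m)

theorem tendsto_nullFraction {C : ℝ} (hC : 0 < C)
    (hhat : Tendsto (fun x : Σ m, Ω m =>
      storeyHat α k lam (weights (b x.1) (p x.1 x.2)) (p x.1 x.2) / (x.1 : ℝ)) (whp P) (𝓝 C)) :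
    Tendsto (fun x : Σ m, Ω m =>
      nullFraction α (lam 0) (storeyEst α k lam (b x.1)) (I₀ x.1) (p x.1 x.2)) (whp P)
      (𝓝 (κ₀ * α / C)) := by
  have hl := h.grid.zero_pos.ne'
  have h1 := ((tendsto_countLE_div h.basic h.tendsto_card
    (h.grid.mem_Ioc (Nat.zero_le k))).div hhat hC.ne').const_mul (α / lam 0)
  rw [show α / lam 0 * (κ₀ * lam 0 / C) = κ₀ * α / C by field_simp] at h1
  refine h1.congr' ?_
  filter_upwards [tendsto_fst_whp.eventually (eventually_ge_atTop 1)] with x hx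
  have hx' : (x.1 : ℝ) ≠ 0 := by positivity
  simp only [nullFraction, h.est_eq hx, Pi.div_apply]
  rw [div_div_div_cancel_right₀ hx']

/-- The lower truncation point of the estimator stays below `m`. -/
theorem exists_eventually_cap_le : ∃ c < 1, ∀ᶠ x : Σ m, Ω m in whp P,
    α / lam 0 * empCDF Finset.univ (p x.1 x.2) (lam 0) ≤ c := by
  obtain ⟨c, hc1, hc2⟩ := exists_between h.cap_lt_one
  refine ⟨c, hc2, ?_⟩
  have h1 := ((tendsto_countLE_div h.basic h.tendsto_card
    (h.grid.mem_Ioc (Nat.zero_le k))).add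
    ((tendsto_compl_card_div h.tendsto_card).comp tendsto_fst_whp)).const_mul (α / lam 0)
  filter_upwards [h1.eventually_lt_const hc1] with x hx
  refine le_trans ?_ hx.le
  rw [empCDF_univ_eq (I₀ x.1)]
  have hl := h.grid.zero_pos
  have hα := h.alpha_pos
  refine mul_le_mul_of_nonneg_left ?_ (by positivity)
  simp only [Function.comp_apply]
  gcongr
  exact mul_le_of_le_one_right (by positivity) (empCDF_mem_Icc _ _ _).2

theorem tendsto_empCDF_of_kappa_eq_one (hκ : κ₀ = 1) {i : ℕ} (hi : i ≤ k) :
    Tendsto (fun x : Σ m, Ω m => empCDF Finset.univ (p x.1 x.2) (lam i)) (whp P)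
      (𝓝 (lam i)) := by
  have h1 := tendsto_countLE_div h.basic h.tendsto_card (h.grid.mem_Ioc hi)
  have h2 := (tendsto_compl_card_div h.tendsto_card).comp (tendsto_fst_whp (P := P))
  rw [hκ, sub_self] at h2
  have h3 : Tendsto (fun x : Σ m, Ω m => (((I₀ x.1)ᶜ.card : ℕ) : ℝ) / (x.1 : ℝ) *
      empCDF (I₀ x.1)ᶜ (p x.1 x.2) (lam i)) (whp P) (𝓝 0) := by
    refine squeeze_zero (fun x => ?_) (fun x => ?_) h2
    · have := (empCDF_mem_Icc (I₀ x.1)ᶜ (p x.1 x.2) (lam i)).1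
      positivity
    · exact mul_le_of_le_one_right (by positivity) (empCDF_mem_Icc _ _ _).2
  have h4 := h1.add h3
  rw [hκ, one_mul, add_zero] at h4
  exact h4.congr fun x => (empCDF_univ_eq (I₀ x.1) _ _).symm

/-- Each interval estimator over m tends to one. The random weights need not converge: they lie in
[0, 1] and sum to one, so the weighted deviations still vanish. -/
theorem tendsto_storeyHat_of_kappa_eq_one (hκ : κ₀ = 1) :
    Tendsto (fun x : Σ m, Ω m =>
      storeyHat α k lam (weights (b x.1) (p x.1 x.2)) (p x.1 x.2) / (x.1 : ℝ)) (whp P)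
      (𝓝 1) := by
  let u : ℕ → (Σ m, Ω m) → ℝ := fun i x =>
    (empCDF Finset.univ (p x.1 x.2) (lam (i + 1)) - empCDF Finset.univ (p x.1 x.2) (lam i) +
      1 / (x.1 : ℝ)) / (lam (i + 1) - lam i)
  have hu : ∀ i < k, Tendsto (fun x => u i x - 1) (whp P) (𝓝 0) := by
    intro i hi
    have h1 := ((((h.tendsto_empCDF_of_kappa_eq_one hκ (i := i + 1) (by omega)).sub
      (h.tendsto_empCDF_of_kappa_eq_one hκ (i := i) hi.le)).add
      (tendsto_const_div_fst_whp 1)).div_const (lam (i + 1) - lam i)).sub_const 1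
    rwa [add_zero, div_self (h.grid.gap_pos hi).ne', sub_self] at h1
  have hsum : Tendsto (fun x : Σ m, Ω m => ∑ i ∈ Finset.range k,
      weights (b x.1) (p x.1 x.2) (i + 1) * (u i x - 1)) (whp P) (𝓝 0) := by
    rw [← Finset.sum_const_zero (s := Finset.range k)]
    refine tendsto_finsetSum _ fun i hi => ?_
    rw [Finset.mem_range] at hi
    have hmem : i + 1 ∈ Finset.Icc 1 k := Finset.mem_Icc.2 ⟨by omega, by omega⟩
    refine squeeze_zero_norm (fun x => ?_) (tendsto_zero_iff_norm_tendsto_zero.1 (hu i hi))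
    rw [norm_mul]
    refine mul_le_of_le_one_left (norm_nonneg _) ?_
    exact abs_le_one_of_mem_Icc ⟨h.weights_nonneg x.1 x.2 _ hmem,
      weight_le_one (h.weights_nonneg x.1 x.2) (h.weights_sum x.1 x.2) hmem⟩
  have hcomb := (hsum.const_add 1).max
    ((h.tendsto_empCDF_of_kappa_eq_one hκ (Nat.zero_le k)).const_mul (α / lam 0))
  rw [add_zero, div_mul_cancel₀ _ h.grid.zero_pos.ne', max_eq_left h.alpha_lt_one.le] at hcomb
  refine hcomb.congr' ?_
  filter_upwards [tendsto_fst_whp.eventually (eventually_ge_atTop 1)] with x hx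
  rw [storeyHat_div hx, storeyComb_div hx]
  congr 1
  simp only [mul_sub, mul_one, Finset.sum_sub_distrib]
  rw [← sum_Icc_one_eq_sum_range k (weights (b x.1) (p x.1 x.2)), h.weights_sum]
  ring

theorem tendsto_integral_fdp_of_tendsto {C : ℝ} (hC : 0 < C)
    (hhat : Tendsto (fun x : Σ m, Ω m =>
      storeyHat α k lam (weights (b x.1) (p x.1 x.2)) (p x.1 x.2) / (x.1 : ℝ)) (whp P) (𝓝 C)) :
    Tendsto (fun m => ∫ ω, fdpStorey α k lam (b m) (I₀ m) (p m ω) ∂(P m)) atTop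
      (𝓝 (κ₀ * α / C)) := by
  simp only [h.integral_fdp]
  exact tendsto_integral_of_tendsto_whp
    (fun m => ((h.nullEstimator m).measurable_nullFraction _).comp (h.basic m).measurable_fun)
    (B := 1) (fun m ω => abs_le_one_of_mem_Icc ((h.nullEstimator m).nullFraction_mem_Icc _ _))
    (h.tendsto_nullFraction hC hhat)

/-- If the estimator stays below a fixed fraction of `m`, the limiting false discovery rate
exceeds that of the Benjamini-Hochberg test. -/
theorem lt_liminf_integral_fdp {c : ℝ} (hc : c < 1)
    (hhat : ∀ᶠ x : Σ m, Ω m in whp P,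
      storeyHat α k lam (weights (b x.1) (p x.1 x.2)) (p x.1 x.2) / (x.1 : ℝ) ≤ c) :
    κ₀ * α < liminf (fun m => ∫ ω, fdpStorey α k lam (b m) (I₀ m) (p m ω) ∂(P m)) atTop := by
  have hl := h.grid.zero_pos
  have hα := h.alpha_pos
  have hκ := h.kappa_pos
  -- The bound is made positive, and `r` is placed strictly between it and 1 to absorb the error of
  -- the null count; this leaves `w` strictly above `κ₀ α`.
  let c' : ℝ := max c (1 / 2)
  have hc' : c' < 1 := max_lt hc (by norm_num)
  have hc0 : 0 < c' := lt_of_lt_of_le (by norm_num) (le_max_right _ _)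
  let r : ℝ := (1 + c') / 2
  have hr1 : r < 1 := by simp only [r]; linarith
  have hrc : c' < r := by simp only [r]; linarith
  let w : ℝ := κ₀ * α * (r / c')
  have hw : κ₀ * α < w := lt_mul_of_one_lt_right (by positivity) ((one_lt_div hc0).2 hrc)
  let W : ∀ m, Ω m → ℝ := fun m ω =>
    nullFraction α (lam 0) (storeyEst α k lam (b m)) (I₀ m) (p m ω)
  have hW01 : ∀ m ω, W m ω ∈ Set.Icc (0 : ℝ) 1 := fun m ω =>
    (h.nullEstimator m).nullFraction_mem_Icc _ _
  have hWm : ∀ m, Measurable (W m) := fun m =>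
    ((h.nullEstimator m).measurable_nullFraction _).comp (h.basic m).measurable_fun
  have hw0 : 0 < w := lt_trans (by positivity) hw
  have hWw : ∀ᶠ x : Σ m, Ω m in whp P, w ≤ W x.1 x.2 := by
    have h1 := (tendsto_countLE_div h.basic h.tendsto_card
      (h.grid.mem_Ioc (Nat.zero_le k))).eventually_const_lt
      (mul_lt_of_lt_one_right (show 0 < κ₀ * lam 0 by positivity) hr1)
    filter_upwards [hhat, h1, tendsto_fst_whp.eventually (eventually_ge_atTop 1)]
      with x hx1 hx2 hx
    have hx' : (0 : ℝ) < x.1 := by exact_mod_cast hx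
    have hpos := (h.nullEstimator x.1).pos (p x.1 x.2)
    rw [h.est_eq hx] at hpos
    simp only [W, nullFraction, h.est_eq hx]
    rw [← div_div_div_cancel_right₀ hx'.ne' (countLE (I₀ x.1) (p x.1 x.2) (lam 0) : ℝ)]
    calc w = α / lam 0 * (κ₀ * lam 0 * r / c') := by simp only [w]; field_simp
      _ ≤ _ := by
        have := le_max_left c (1 / 2)
        gcongr
        exact hx1.trans this
  -- `W` need not have a limit, but its truncation at `w` converges to `w`, which is enough for a
  -- lower bound on the means.
  have hmin : Tendsto (fun m => ∫ ω, min (W m ω) w ∂(P m)) atTop (𝓝 w) := by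
    refine tendsto_integral_of_tendsto_whp (fun m => (hWm m).min measurable_const) (B := w)
      (fun m ω => ?_) (tendsto_const_nhds.congr' ?_)
    · rw [abs_of_nonneg (le_min (hW01 m ω).1 hw0.le)]
      exact min_le_right _ _
    · filter_upwards [hWw] with x hx
      exact (min_eq_right hx).symm
  obtain ⟨w', hw'1, hw'2⟩ := exists_between hw
  refine hw'1.trans_le (le_liminf_of_le ?_ ?_)
  · refine IsBoundedUnder.isCoboundedUnder_ge (isBoundedUnder_of ⟨1, fun m => ?_⟩)
    rw [h.integral_fdp]
    calc _ ≤ ∫ _, (1 : ℝ) ∂(P m) := integral_mono_of_nonneg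
          (ae_of_all _ fun ω => (hW01 m ω).1) (integrable_const _)
          (ae_of_all _ fun ω => (hW01 m ω).2)
      _ = 1 := by simp
  · filter_upwards [hmin.eventually_const_lt hw'2] with m hm
    rw [h.integral_fdp]
    refine hm.le.trans (integral_mono_of_nonneg
      (ae_of_all _ fun ω => le_min (hW01 m ω).1 hw0.le) ?_
      (ae_of_all _ fun ω => min_le_left _ _))
    exact Integrable.of_bound (hWm m).aestronglyMeasurable 1
      (ae_of_all _ fun ω => abs_le_one_of_mem_Icc (hW01 m ω))

theorem exists_eventually_storeyHat_le
    (hmono : ∀ m, ∀ᵐ ω ∂(P m), MonotoneWeights k lam (weights (b m) (p m ω)))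
    {ε : ℕ → ℝ} (hε : ∀ i < k, 0 ≤ ε i)
    (hF : ∀ i < k, ∀ η > 0, ∀ᶠ x : Σ m, Ω m in whp P,
      lam i + ε i - η < empCDF Finset.univ (p x.1 x.2) (lam i))
    {j : ℕ} (hj : j ∈ Finset.Icc 1 k) {δ : ℝ} (hδ : 0 < δ) (hεj : 0 < ε (j - 1))
    (hd : ∀ᶠ x : Σ m, Ω m in whp P, δ ≤ normWeight lam (weights (b x.1) (p x.1 x.2)) j -
      normWeight lam (weights (b x.1) (p x.1 x.2)) (j - 1)) :
    ∃ c < 1, ∀ᶠ x : Σ m, Ω m in whp P,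
      storeyHat α k lam (weights (b x.1) (p x.1 x.2)) (p x.1 x.2) / (x.1 : ℝ) ≤ c := by
  obtain ⟨c, hc, hcap⟩ := h.exists_eventually_cap_le
  have hG := h.grid.gridBound_nonneg
  have hδε : 0 < δ * ε (j - 1) := mul_pos hδ hεj
  -- The errors in F cost at most a quarter of `δ * ε (j - 1)` and the O(1/m) term another quarter,
  -- leaving half of it as the gain.
  let η : ℝ := δ * ε (j - 1) / (4 * (gridBound k lam + 1))
  have hη : 0 < η := by positivity
  have hηG : η * gridBound k lam ≤ δ * ε (j - 1) / 4 := by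
    calc η * gridBound k lam ≤ η * (gridBound k lam + 1) := by gcongr; linarith
      _ = δ * ε (j - 1) / 4 := by simp only [η]; field_simp
  refine ⟨max c (1 - δ * ε (j - 1) / 2), max_lt hc (by linarith), ?_⟩
  have hFall : ∀ᶠ x : Σ m, Ω m in whp P, ∀ i ∈ Finset.range k,
      lam i + ε i - η < empCDF Finset.univ (p x.1 x.2) (lam i) :=
    (Finset.eventually_all _).2 fun i hi => hF i (Finset.mem_range.1 hi) η hη
  have hGm := tendsto_const_div_fst_whp (P := P) (gridBound k lam)
  filter_upwards [hcap, hFall, hd, eventually_whp_of_forall_ae hmono,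
    hGm.eventually_lt_const (show 0 < δ * ε (j - 1) / 4 by positivity),
    tendsto_fst_whp.eventually (eventually_ge_atTop 1)] with x h1 h2 h3 h4 h5 h6
  rw [storeyHat_div h6]
  refine max_le ?_ (h1.trans (le_max_left _ _))
  refine le_trans ?_ (le_max_right _ _)
  have key := storeyComb_div_le h.grid h6 (fun i => ((h.basic x.1).mem_Icc x.2 i).2)
    (h.weights_nonneg x.1 x.2) (h.weights_sum x.1 x.2) h4 hε (x := 1) zero_le_one hη.le
    (fun i hi => by linarith [h2 i (Finset.mem_range.2 hi)]) hj
  have h7 := mul_le_mul_of_nonneg_right h3 hεj.le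
  linarith

end AdaptiveSetting

/-! ### Consistency of the adaptive test. -/

namespace AdaptiveSetting

variable {Ω : ℕ → Type*} [∀ m, MeasurableSpace (Ω m)] {P : ∀ m, Measure (Ω m)}
  [∀ m, IsProbabilityMeasure (P m)] {p : ∀ m, Ω m → Fin m → ℝ} {I₀ : ∀ m, Finset (Fin m)}
  {α : ℝ} {k : ℕ} {lam : ℕ → ℝ} {b : ∀ _ : ℕ, ∀ i, (Set.Ici (lam i) → ℝ) → ℝ} {κ₀ : ℝ}
  (h : AdaptiveSetting P p I₀ α k lam b κ₀)
include h

theorem consistent_of_tendsto {C : ℝ} (hC : 0 < C)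
    (hhat : Tendsto (fun x : Σ m, Ω m =>
      storeyHat α k lam (weights (b x.1) (p x.1 x.2)) (p x.1 x.2) / (x.1 : ℝ)) (whp P) (𝓝 C))
    (hR : Tendsto (fun x : Σ m, Ω m =>
      adaptiveRej α (lam 0) (storeyEst α k lam (b x.1)) (p x.1 x.2)) (whp P) atTop) :
    Consistent P fun m ω => fdpStorey α k lam (b m) (I₀ m) (p m ω) := by
  simp only [h.fdp_eq]
  exact consistent_of_tendsto_rej h.basic h.nullEstimator (h.tendsto_nullFraction hC hhat) hR

theorem consistent_of_consistent_fdpBH {C : ℝ} (hC : 0 < C)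
    (hhat : Tendsto (fun x : Σ m, Ω m =>
      storeyHat α k lam (weights (b x.1) (p x.1 x.2)) (p x.1 x.2) / (x.1 : ℝ)) (whp P) (𝓝 C))
    (hle : ∀ᶠ x : Σ m, Ω m in whp P,
      storeyHat α k lam (weights (b x.1) (p x.1 x.2)) (p x.1 x.2) / (x.1 : ℝ) ≤ 1)
    (hc : Consistent P fun m ω => fdpBH α (I₀ m) (p m ω)) :
    Consistent P fun m ω => fdpStorey α k lam (b m) (I₀ m) (p m ω) := by
  refine h.consistent_of_tendsto hC hhat (tendsto_atTop_mono' _ ?_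
    (tendsto_rej_of_consistent h.basic h.alpha_pos h.alpha_lt_one.le h.kappa_pos
      h.tendsto_card hc))
  filter_upwards [hle, tendsto_fst_whp.eventually (eventually_ge_atTop 1)] with x hx hx1
  have hx' : (0 : ℝ) < x.1 := by exact_mod_cast hx1
  refine adaptiveRej_trivialEst_le h.alpha_pos.le h.alpha_le ((h.nullEstimator x.1).pos _) ?_
  rw [h.est_eq hx1]
  exact (div_le_one hx').1 hx

theorem consistent_of_eventually_le {C : ℝ} (hC : 0 < C)
    (hhat : Tendsto (fun x : Σ m, Ω m =>
      storeyHat α k lam (weights (b x.1) (p x.1 x.2)) (p x.1 x.2) / (x.1 : ℝ)) (whp P) (𝓝 C))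
    {δ : ℝ} (hδ : 0 < δ) {t : ℕ → ℝ} (ht : ∀ m, t m ∈ Set.Ioo 0 (lam 0))
    (hmt : Tendsto (fun m : ℕ => (m : ℝ) * t m) atTop atTop)
    (hF : ∀ᶠ x : Σ m, Ω m in whp P, δ - κ₀ + 1 / α * C ≤
      (((I₀ x.1)ᶜ.card : ℕ) : ℝ) / (x.1 : ℝ) *
        (empCDF (I₀ x.1)ᶜ (p x.1 x.2) (t x.1) / t x.1)) :
    Consistent P fun m ω => fdpStorey α k lam (b m) (I₀ m) (p m ω) := by
  have hα := h.alpha_pos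
  -- The margin `δ` is split so that `κ₀ - η` from the nulls plus the assumed bound equals `(C + η)
  -- / α`, while the estimator stays below `(C + η) m`.
  let η : ℝ := δ / (1 + 1 / α)
  have hη : 0 < η := by positivity
  have hηδ : η + 1 / α * η = δ := by
    simp only [η]
    field_simp
  have hηα : 0 < 1 / α * η := by positivity
  have hV := tendsto_countLE_div_mul h.basic h.tendsto_card
    (t := t) (fun m => ⟨(ht m).1, ((ht m).2.trans h.grid.zero_lt).le⟩) hmt
  have hN : ∀ᶠ x : Σ m, Ω m in whp P, 1 / α * (C + η) * (x.1 * t x.1) ≤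
      countLE Finset.univ (p x.1 x.2) (t x.1) := by
    filter_upwards [hF, hV.eventually_const_lt (sub_lt_self κ₀ hη),
      tendsto_fst_whp.eventually (eventually_ge_atTop 1)] with x h1 h2 h3
    have hx' : (0 : ℝ) < x.1 := by exact_mod_cast h3
    have ht' := (ht x.1).1
    have h4 : empCDF Finset.univ (p x.1 x.2) (t x.1) / t x.1 =
        (countLE Finset.univ (p x.1 x.2) (t x.1) : ℝ) / (x.1 * t x.1) := by
      rw [empCDF_eq, Finset.card_univ, Fintype.card_fin, div_div]
    have h5 : empCDF Finset.univ (p x.1 x.2) (t x.1) / t x.1 =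
        (countLE (I₀ x.1) (p x.1 x.2) (t x.1) : ℝ) / (x.1 * t x.1) +
        (((I₀ x.1)ᶜ.card : ℕ) : ℝ) / (x.1 : ℝ) *
          (empCDF (I₀ x.1)ᶜ (p x.1 x.2) (t x.1) / t x.1) := by
      rw [empCDF_univ_eq (I₀ x.1)]
      field_simp
    rw [← le_div_iff₀ (by positivity), ← h4, h5]
    linarith
  have hRN : ∀ᶠ x : Σ m, Ω m in whp P, (countLE Finset.univ (p x.1 x.2) (t x.1) : ℝ) ≤
      adaptiveRej α (lam 0) (storeyEst α k lam (b x.1)) (p x.1 x.2) := by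
    filter_upwards [hN, hhat.eventually_lt_const (lt_add_of_pos_right C hη),
      tendsto_fst_whp.eventually (eventually_ge_atTop 1)] with x h1 h2 h3
    have hx' : (0 : ℝ) < x.1 := by exact_mod_cast h3
    have ht' := (ht x.1).1
    refine Nat.cast_le.2 (countLE_le_adaptiveRej ((h.nullEstimator x.1).pos _) (ht x.1).2.le ?_)
    rw [h.est_eq h3]
    rw [div_lt_iff₀ hx'] at h2
    calc t x.1 * storeyHat α k lam (weights (b x.1) (p x.1 x.2)) (p x.1 x.2)
        ≤ t x.1 * ((C + η) * x.1) := by gcongr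
      _ = 1 / α * (C + η) * (x.1 * t x.1) * α := by field_simp
      _ ≤ _ := by gcongr
  refine h.consistent_of_tendsto hC hhat ?_
  rw [← tendsto_natCast_atTop_iff (R := ℝ)]
  have hlow : Tendsto (fun x : Σ m, Ω m => 1 / α * (C + η) * (x.1 * t x.1)) (whp P) atTop :=
    (hmt.const_mul_atTop (by positivity)).comp tendsto_fst_whp
  exact tendsto_atTop_mono' _ hRN (tendsto_atTop_mono' _ hN hlow)

-- For κ₀ < 1 the number of false nulls is of order m, so the growth condition is automatic.
omit [∀ m, IsProbabilityMeasure (P m)] in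
theorem tendsto_compl_card_div_sqrt
    (hs : κ₀ = 1 →
      Tendsto (fun m : ℕ => (((I₀ m)ᶜ.card : ℕ) : ℝ) / Real.sqrt (m : ℝ)) atTop atTop) :
    Tendsto (fun m : ℕ => (((I₀ m)ᶜ.card : ℕ) : ℝ) / Real.sqrt (m : ℝ)) atTop atTop := by
  rcases h.kappa_le.lt_or_eq with hlt | heq
  · have h1 := (tendsto_compl_card_div h.tendsto_card).pos_mul_atTop (sub_pos.2 hlt)
      (Real.tendsto_sqrt_atTop.comp tendsto_natCast_atTop_atTop)
    refine h1.congr' ?_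
    filter_upwards [eventually_ge_atTop 1] with m hm
    have hm' : (0 : ℝ) < m := by exact_mod_cast hm
    have hsq := Real.mul_self_sqrt hm'.le
    have hs0 := (Real.sqrt_pos.2 hm').ne'
    simp only [Function.comp_apply]
    rw [div_mul_eq_mul_div, div_eq_div_iff hm'.ne' hs0, mul_assoc, hsq]
  · exact hs heq

/-- With sufficiently many false nulls the estimator is at most `m`. -/
theorem eventually_storeyHat_le_one
    (hmono : ∀ m, ∀ᵐ ω ∂(P m), MonotoneWeights k lam (weights (b m) (p m ω)))
    {ε : ℕ → ℝ} (hε : ∀ i < k, 0 ≤ ε i)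
    (hF : ∀ i < k, Tendsto (fun x : Σ m, Ω m => empCDF (I₀ x.1)ᶜ (p x.1 x.2) (lam i)) (whp P)
      (𝓝 (lam i + ε i)))
    {j : ℕ} (hj : j ∈ Finset.Icc 1 k) {δ : ℝ} (hδ : 0 < δ) (hεj : 0 < ε (j - 1))
    (hd : ∀ᶠ x : Σ m, Ω m in whp P, δ ≤ normWeight lam (weights (b x.1) (p x.1 x.2)) j -
      normWeight lam (weights (b x.1) (p x.1 x.2)) (j - 1))
    (hs : Tendsto (fun m : ℕ => (((I₀ m)ᶜ.card : ℕ) : ℝ) / Real.sqrt (m : ℝ)) atTop atTop) :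
    ∀ᶠ x : Σ m, Ω m in whp P,
      storeyHat α k lam (weights (b x.1) (p x.1 x.2)) (p x.1 x.2) / (x.1 : ℝ) ≤ 1 := by
  obtain ⟨c, hc, hcap⟩ := h.exists_eventually_cap_le
  have hG := h.grid.gridBound_nonneg
  have hδε : 0 < δ * ε (j - 1) := mul_pos hδ hεj
  -- Chosen so that the errors in F and the O(1/m) term, all on the scale m₁/m, together do not
  -- exceed the gain `δ * ε (j - 1)`.
  let η : ℝ := δ * ε (j - 1) / (gridBound k lam + 1)
  have hη : 0 < η := by positivity
  have hηG : η * (gridBound k lam + 1) = δ * ε (j - 1) := by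
    simp only [η]; field_simp
  have hcard : Tendsto (fun m : ℕ => (((I₀ m)ᶜ.card : ℕ) : ℝ)) atTop atTop := by
    refine tendsto_atTop_mono' _ ?_ hs
    filter_upwards [eventually_ge_atTop 1] with m hm
    refine div_le_self (Nat.cast_nonneg _) (Real.one_le_sqrt.2 ?_)
    exact_mod_cast hm
  -- Null counts fluctuate on the scale √m, negligible against m₁; Chebyshev needs m/m₁² → 0.
  have hV : ∀ i < k, Tendsto (fun y : Σ m, Ω m =>
      ((countLE (I₀ y.1) (p y.1 y.2) (lam i) : ℝ) - (I₀ y.1).card * lam i) /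
        (((I₀ y.1)ᶜ.card : ℕ) : ℝ)) (whp P) (𝓝 0) := by
    intro i hi
    have hmem := h.grid.mem_Ioc hi.le
    refine tendsto_countLE_sub_div h.basic (t := fun _ => lam i)
      (x := fun m => (((I₀ m)ᶜ.card : ℕ) : ℝ))
      (fun _ => ⟨hmem.1.le, hmem.2⟩) (hcard.eventually_gt_atTop 0) ?_
    have h1 := ((tendsto_inv_atTop_zero.comp hs).pow 2).mul_const (lam i)
    rw [zero_pow two_ne_zero, zero_mul] at h1
    refine h1.congr fun m => ?_
    simp only [Function.comp_apply]
    rw [inv_pow, div_pow, Real.sq_sqrt (Nat.cast_nonneg m), inv_div]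
    ring
  have hall : ∀ᶠ x : Σ m, Ω m in whp P, ∀ i ∈ Finset.range k,
      -(η / 2) < ((countLE (I₀ x.1) (p x.1 x.2) (lam i) : ℝ) - (I₀ x.1).card * lam i) /
        (((I₀ x.1)ᶜ.card : ℕ) : ℝ) ∧
      lam i + ε i - η / 2 < empCDF (I₀ x.1)ᶜ (p x.1 x.2) (lam i) := by
    refine (Finset.eventually_all _).2 fun i hi => ?_
    rw [Finset.mem_range] at hi
    exact ((hV i hi).eventually_const_lt (by linarith)).and
      ((hF i hi).eventually_const_lt (by linarith))
  filter_upwards [hcap, hall, hd, eventually_whp_of_forall_ae hmono,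
    tendsto_fst_whp.eventually (eventually_ge_atTop 1),
    tendsto_fst_whp.eventually (hcard.eventually_ge_atTop (gridBound k lam / η)),
    tendsto_fst_whp.eventually (hcard.eventually_gt_atTop 0)] with x h1 h2 h3 h4 h5 h6 h7
  rw [storeyHat_div h5]
  refine max_le ?_ (h1.trans hc.le)
  have hx : (0 : ℝ) < x.1 := by exact_mod_cast h5
  set m₁ : ℝ := (((I₀ x.1)ᶜ.card : ℕ) : ℝ) with hm₁
  have hm₀ : ((I₀ x.1).card : ℝ) = x.1 - m₁ := by
    have : (I₀ x.1).card + (I₀ x.1)ᶜ.card = x.1 := by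
      simp
    rw [hm₁, eq_sub_iff_add_eq]
    exact_mod_cast this
  have hx1 : 0 ≤ m₁ / x.1 := by positivity
  have key := storeyComb_div_le h.grid h5 (fun i => ((h.basic x.1).mem_Icc x.2 i).2)
    (h.weights_nonneg x.1 x.2) (h.weights_sum x.1 x.2) h4 hε (x := m₁ / x.1) hx1 hη.le
    (fun i hi => by
      obtain ⟨ha, hb⟩ := h2 i (Finset.mem_range.2 hi)
      -- Since m₀ = m - m₁, the excess of F over the diagonal factors through m₁/m, including the
      -- null fluctuation.
      have he : empCDF Finset.univ (p x.1 x.2) (lam i) = lam i + m₁ / x.1 *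
          (((countLE (I₀ x.1) (p x.1 x.2) (lam i) : ℝ) - (I₀ x.1).card * lam i) / m₁ +
            (empCDF (I₀ x.1)ᶜ (p x.1 x.2) (lam i) - lam i)) := by
        rw [empCDF_univ_eq (I₀ x.1), ← hm₁, hm₀]
        field_simp
        ring
      rw [he]
      gcongr
      linarith) hj
  have h8 : gridBound k lam / x.1 ≤ m₁ / x.1 * η := by
    rw [div_le_iff₀ hη] at h6
    rw [div_mul_eq_mul_div]
    gcongr
  have h9 := mul_le_mul_of_nonneg_left (mul_le_mul_of_nonneg_right h3 hεj.le) hx1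
  have h10 : m₁ / x.1 * (η * (gridBound k lam + 1)) = m₁ / x.1 * (δ * ε (j - 1)) := by rw [hηG]
  linarith

omit [∀ m, IsProbabilityMeasure (P m)] h in
theorem tendsto_normWeight {β : ℕ → ℝ}
    (hβ : ∀ i ∈ Finset.Icc 1 k, Tendsto (fun x : Σ m, Ω m => weights (b x.1) (p x.1 x.2) i)
      (whp P) (𝓝 (β i))) {i : ℕ} (hi : i ≤ k) :
    Tendsto (fun x : Σ m, Ω m => normWeight lam (weights (b x.1) (p x.1 x.2)) i) (whp P)
      (𝓝 (normWeight lam β i)) := by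
  rcases Nat.eq_zero_or_pos i with rfl | h0
  · simp only [normWeight, if_true]
    exact tendsto_const_nhds
  · simp only [normWeight, h0.ne', if_false]
    exact (hβ i (Finset.mem_Icc.2 ⟨h0, hi⟩)).div_const _

/-- The estimator divided by `m` has a limit, which is at least `α`. -/
theorem exists_tendsto_storeyHat {β : ℕ → ℝ}
    (hβ : ∀ i ∈ Finset.Icc 1 k, Tendsto (fun x : Σ m, Ω m => weights (b x.1) (p x.1 x.2) i)
      (whp P) (𝓝 (β i)))
    {ε : ℕ → ℝ} (hε : ∀ i < k, 0 ≤ ε i)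
    (hF : ∀ i < k, Tendsto (fun x : Σ m, Ω m => empCDF (I₀ x.1)ᶜ (p x.1 x.2) (lam i)) (whp P)
      (𝓝 (lam i + ε i))) :
    ∃ C, α ≤ C ∧ Tendsto (fun x : Σ m, Ω m =>
      storeyHat α k lam (weights (b x.1) (p x.1 x.2)) (p x.1 x.2) / (x.1 : ℝ)) (whp P)
      (𝓝 C) := by
  -- The last grid point is separate: there F equals one for m ≥ 1, and `ε` is only controlled below
  -- `k`.
  let f : ℕ → ℝ := fun i => if i < k then lam i + (1 - κ₀) * ε i else 1
  have hf : ∀ i ≤ k, Tendsto (fun x : Σ m, Ω m => empCDF Finset.univ (p x.1 x.2) (lam i))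
      (whp P) (𝓝 (f i)) := by
    intro i hi
    rcases hi.lt_or_eq with hlt | rfl
    · simp only [f, hlt, if_true]
      have h1 := (tendsto_countLE_div h.basic h.tendsto_card (h.grid.mem_Ioc hi)).add
        (((tendsto_compl_card_div h.tendsto_card).comp tendsto_fst_whp).mul (hF i hlt))
      rw [show κ₀ * lam i + (1 - κ₀) * (lam i + ε i) = lam i + (1 - κ₀) * ε i by ring] at h1
      exact h1.congr fun x => (empCDF_univ_eq (I₀ x.1) _ _).symm
    · simp only [f, lt_irrefl, if_false]
      refine tendsto_const_nhds.congr' ?_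
      filter_upwards [tendsto_fst_whp.eventually (eventually_ge_atTop 1)] with x hx
      exact (empCDF_univ_eq_one hx fun n =>
        ((h.basic x.1).mem_Icc x.2 n).2.trans h.grid.last.ge).symm
  have hcomb : Tendsto (fun x : Σ m, Ω m => ∑ i ∈ Finset.range k,
      weights (b x.1) (p x.1 x.2) (i + 1) *
      ((empCDF Finset.univ (p x.1 x.2) (lam (i + 1)) - empCDF Finset.univ (p x.1 x.2) (lam i) +
        1 / (x.1 : ℝ)) / (lam (i + 1) - lam i))) (whp P)
      (𝓝 (∑ i ∈ Finset.range k, β (i + 1) *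
        ((f (i + 1) - f i + 0) / (lam (i + 1) - lam i)))) := by
    refine tendsto_finsetSum _ fun i hi => ?_
    rw [Finset.mem_range] at hi
    exact (hβ (i + 1) (Finset.mem_Icc.2 ⟨by omega, by omega⟩)).mul
      ((((hf (i + 1) (by omega)).sub (hf i hi.le)).add (tendsto_const_div_fst_whp 1)).div_const _)
  refine ⟨_, ?_, (hcomb.max ((hf 0 (Nat.zero_le k)).const_mul (α / lam 0))).congr' ?_⟩
  -- The second branch of the maximum tends to `α / lam 0` times a limit that is at least `lam 0`;
  -- this makes the limit of the estimator positive.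
  · refine le_trans ?_ (le_max_right _ _)
    have hl := h.grid.zero_pos
    have hα := h.alpha_pos
    have h1 : 0 ≤ (1 - κ₀) * ε 0 := mul_nonneg (sub_nonneg.2 h.kappa_le) (hε 0 h.grid.k_pos)
    simp only [f, h.grid.k_pos, if_true]
    calc α = α / lam 0 * lam 0 := by field_simp
      _ ≤ _ := by gcongr; linarith
  · filter_upwards [tendsto_fst_whp.eventually (eventually_ge_atTop 1)] with x hx
    rw [storeyHat_div hx, storeyComb_div hx]

end AdaptiveSetting

end MultipleTesting

/-! ### Assembly of the three statements. -/

theorem corollary5p5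
    {Ω : ℕ → Type*} [∀ m, MeasurableSpace (Ω m)]
    (P : ∀ m, Measure (Ω m)) [∀ m, IsProbabilityMeasure (P m)]
    (p : ∀ m, Ω m → Fin m → ℝ) (I₀ : ∀ m, Finset (Fin m))
    (hBI : ∀ m, BasicIndependence (P m) (p m) (I₀ m))
    (α : ℝ) (hα : 0 < α)
    (k : ℕ) (lam : ℕ → ℝ) (hαlam : α ≤ lam 0) (hlam0 : lam 0 < 1)
    (hlam : ∀ i < k, lam i < lam (i + 1)) (hlamk : lam k = 1)
    (b : ∀ _ : ℕ, ∀ i, (Set.Ici (lam i) → ℝ) → ℝ)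
    (hb_meas : ∀ m, ∀ i ∈ Finset.Icc 1 k, Measurable (b m i))
    (hb_nonneg : ∀ m, ∀ ω : Ω m, ∀ i ∈ Finset.Icc 1 k, 0 ≤ weights (b m) (p m ω) i)
    (hb_sum : ∀ m, ∀ ω : Ω m, ∑ i ∈ Finset.Icc 1 k, weights (b m) (p m ω) i = 1)
    (κ₀ : ℝ) (hκ₀ : 0 < κ₀) (hκ₀_le : κ₀ ≤ 1)
    (hA1 : Tendsto (fun m : ℕ => ((I₀ m).card : ℝ) / (m : ℝ)) atTop (𝓝 κ₀))
    (hA5 : α * (1 - κ₀) / (lam 0 * (1 - α)) < κ₀) :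
    -- (a)
    (κ₀ = 1 →
      ConvInProb P (fun m ω => storeyHat α k lam (weights (b m) (p m ω)) (p m ω) / (m : ℝ)) 1 ∧
      Tendsto (fun m => ∫ ω, fdpStorey α k lam (b m) (I₀ m) (p m ω) ∂(P m)) atTop (𝓝 α) ∧
      Tendsto (fun m => ∫ ω, fdpBH α (I₀ m) (p m ω) ∂(P m)) atTop (𝓝 α)) ∧
    -- (b)
    (∀ Q : Measure (∀ m, Ω m), IsJointLaw P Q →
      κ₀ < 1 →
      (∀ m, ∀ᵐ ω ∂(P m), MonotoneWeights k lam (weights (b m) (p m ω))) →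
      ∀ ε : ℕ → ℝ, (∀ i < k, ε i ∈ Set.Icc 0 (1 - lam i)) →
      (∀ i < k, ∀ᵐ ω ∂Q,
        lam i + ε i ≤ liminf (fun m => empCDF Finset.univ (p m (ω m)) (lam i)) atTop) →
      (∃ j ∈ Finset.Icc 1 k, ∃ δ : ℝ, 0 < δ ∧
        (∀ᵐ ω ∂Q, δ ≤ liminf (fun m => normWeight lam (weights (b m) (p m (ω m))) j
          - normWeight lam (weights (b m) (p m (ω m))) (j - 1)) atTop) ∧
        0 < ε (j - 1)) →
      κ₀ * α < liminf (fun m => ∫ ω, fdpStorey α k lam (b m) (I₀ m) (p m ω) ∂(P m)) atTop ∧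
      Tendsto (fun m => ∫ ω, fdpBH α (I₀ m) (p m ω) ∂(P m)) atTop (𝓝 (κ₀ * α))) ∧
    -- (c)
    (∀ Q : Measure (∀ m, Ω m), IsJointLaw P Q →
      ∀ β : ℕ → ℝ,
      (∀ i ∈ Finset.Icc 1 k,
        ∀ᵐ ω ∂Q, Tendsto (fun m => weights (b m) (p m (ω m)) i) atTop (𝓝 (β i))) →
      (∀ m, ∀ᵐ ω ∂(P m), MonotoneWeights k lam (weights (b m) (p m ω))) →
      ∀ ε : ℕ → ℝ, (∀ i < k, ε i ∈ Set.Icc 0 (1 - lam i)) →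
      (∀ i < k, ∀ᵐ ω ∂Q,
        Tendsto (fun m => empCDF (I₀ m)ᶜ (p m (ω m)) (lam i)) atTop (𝓝 (lam i + ε i))) →
      (∃ j ∈ Finset.Icc 1 k, 0 < normWeight lam β j - normWeight lam β (j - 1) ∧ 0 < ε (j - 1)) →
      (κ₀ = 1 →
        Tendsto (fun m : ℕ => (((I₀ m)ᶜ.card : ℕ) : ℝ) / Real.sqrt (m : ℝ)) atTop atTop) →
      ∃ C₀ ∈ Set.Icc (κ₀ * α) 1,
        ConvInProb P
          (fun m ω => storeyHat α k lam (weights (b m) (p m ω)) (p m ω) / (m : ℝ)) C₀ ∧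
        (Consistent P (fun m ω => fdpBH α (I₀ m) (p m ω)) →
          Consistent P (fun m ω => fdpStorey α k lam (b m) (I₀ m) (p m ω))) ∧
        (∀ δ : ℝ, 0 < δ → ∀ t : ℕ → ℝ, (∀ m, t m ∈ Set.Ioo 0 (lam 0)) →
          Tendsto (fun m : ℕ => (m : ℝ) * t m) atTop atTop →
          Tendsto (fun m : ℕ => P m {ω | δ - κ₀ + 1 / α * C₀ ≤
              (((I₀ m)ᶜ.card : ℕ) : ℝ) / (m : ℝ) *
                (empCDF (I₀ m)ᶜ (p m ω) (t m) / t m)}) atTop (𝓝 1) →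
          Consistent P (fun m ω => fdpStorey α k lam (b m) (I₀ m) (p m ω)))) := by
  have h : AdaptiveSetting P p I₀ α k lam b κ₀ :=
    { basic := hBI
      alpha_pos := hα
      alpha_le := hαlam
      grid := ⟨hα.trans_le hαlam, hlam0, hlam, hlamk⟩
      weights_meas := hb_meas
      weights_nonneg := hb_nonneg
      weights_sum := hb_sum
      kappa_pos := hκ₀
      kappa_le := hκ₀_le
      tendsto_card := hA1
      kappa_lt := hA5 }
  have hBH := tendsto_integral_fdpBH hBI hα h.alpha_lt_one.le hA1
  refine ⟨fun hκ => ?_, fun Q hQ _ hmono ε hε hF ⟨j, hj, δ, hδ, hd, hεj⟩ => ⟨?_, hBH⟩,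
    fun Q hQ β hβ hmono ε hε hF ⟨j, hj, hd, hεj⟩ hs => ?_⟩
  · have hhat := h.tendsto_storeyHat_of_kappa_eq_one hκ
    have hfdp := h.tendsto_integral_fdp_of_tendsto one_pos hhat
    rw [hκ, one_mul, div_one] at hfdp
    rw [hκ, one_mul] at hBH
    exact ⟨convInProb_iff_tendsto_whp.2 hhat, hfdp, hBH⟩
  · have hj' := Finset.mem_Icc.1 hj
    have hgm : ∀ m, ∀ i ≤ k, Measurable fun ω => normWeight lam (weights (b m) (p m ω)) i := by
      intro m i hi
      rcases Nat.eq_zero_or_pos i with rfl | h0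
      · simp only [normWeight, if_true]
        exact measurable_const
      · simp only [normWeight, h0.ne', if_false]
        exact (h.measurable_weights_comp m (Finset.mem_Icc.2 ⟨h0, hi⟩)).div_const _
    -- Half of `δ` is given up to obtain a strict eventual bound. The uniform lower bound
    -- `-gridBound k lam` is required for the real-valued lower limit to be meaningful.
    have hd' := eventually_whp_lt_of_ae_le_liminf hQ
      (X := fun m ω => normWeight lam (weights (b m) (p m ω)) j -
        normWeight lam (weights (b m) (p m ω)) (j - 1))
      (fun m => (hgm m j hj'.2).sub (hgm m (j - 1) (by omega))) (B := -gridBound k lam)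
      (fun m ω => by
        have h1 := normWeight_le h.grid (hb_nonneg m ω) (hb_sum m ω) (i := j - 1) (by omega)
        have h2 := normWeight_nonneg h.grid (hb_nonneg m ω) (i := j - 1) (by omega)
        rw [show j - 1 + 1 = j by omega] at h2
        linarith) (half_lt_self hδ) hd
    obtain ⟨c, hc, hle⟩ := h.exists_eventually_storeyHat_le hmono (fun i hi => (hε i hi).1)
      (fun i hi η hη => eventually_whp_lt_of_ae_le_liminf hQ
        (X := fun m ω => empCDF Finset.univ (p m ω) (lam i))
        (fun m => h.measurable_empCDF_comp (fun _ => Finset.univ) m (lam i)) (B := 0)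
        (fun m ω => (empCDF_mem_Icc _ _ _).1) (sub_lt_self _ hη) (hF i hi))
      hj (half_pos hδ) hεj (hd'.mono fun _ hx => hx.le)
    exact h.lt_liminf_integral_fdp hc hle
  · have hj' := Finset.mem_Icc.1 hj
    have hβ' : ∀ i ∈ Finset.Icc 1 k, Tendsto (fun x : Σ m, Ω m =>
        weights (b x.1) (p x.1 x.2) i) (whp P) (𝓝 (β i)) := fun i hi =>
      tendsto_whp_of_ae_tendsto hQ (X := fun m ω => weights (b m) (p m ω) i)
        (fun m => h.measurable_weights_comp m hi) (hβ i hi)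
    have hF' : ∀ i < k, Tendsto (fun x : Σ m, Ω m =>
        empCDF (I₀ x.1)ᶜ (p x.1 x.2) (lam i)) (whp P) (𝓝 (lam i + ε i)) := fun i hi =>
      tendsto_whp_of_ae_tendsto hQ (X := fun m ω => empCDF (I₀ m)ᶜ (p m ω) (lam i))
        (fun m => h.measurable_empCDF_comp (fun m => (I₀ m)ᶜ) m (lam i)) (hF i hi)
    have hε' : ∀ i < k, 0 ≤ ε i := fun i hi => (hε i hi).1
    obtain ⟨C, hC, hhat⟩ := h.exists_tendsto_storeyHat hβ' hε' hF'
    have hC0 : 0 < C := hα.trans_le hC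
    have hd' := ((AdaptiveSetting.tendsto_normWeight hβ' hj'.2).sub
      (AdaptiveSetting.tendsto_normWeight hβ' (i := j - 1) (by omega))).eventually_const_lt
      (half_lt_self hd)
    have hle := h.eventually_storeyHat_le_one hmono hε' hF' hj (half_pos hd) hεj
      (hd'.mono fun _ hx => hx.le) (h.tendsto_compl_card_div_sqrt hs)
    -- The bounds on the limit are κ₀α ≤ α ≤ C and, because the ratio is at most one with
    -- probability tending to one, C ≤ 1.
    refine ⟨C, ⟨(mul_le_of_le_one_left hα.le hκ₀_le).trans hC, le_of_tendsto hhat hle⟩,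
      convInProb_iff_tendsto_whp.2 hhat, h.consistent_of_consistent_fdpBH hC0 hhat hle,
      fun δ hδ t ht hmt hP => h.consistent_of_eventually_le hC0 hhat hδ ht hmt ?_⟩
    refine (eventually_whp_iff_tendsto_measure_one fun m => ?_).2 hP
    exact measurableSet_le measurable_const
      (((h.measurable_empCDF_comp (fun m => (I₀ m)ᶜ) m (t m)).div_const _).const_mul _)
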